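/- Let $\mathbb F_q$ be the finite field with $q$ elements and $\overline{\mathbb F}_q$ an algebraic closure; all fields $\mathbb F_{q^t}$ are taken inside it. For $a\in\overline{\mathbb F}_q^{\,*}$ let $\mathrm{ord}(a)$ be its multiplicative order. For an irreducible $g\in\mathbb F_q[X]$, $g\ne X$, let $\mathrm{ord}(g)$ be the least $e\ge 1$ with $g\mid X^e-1$. Let $\mathrm{rad}(n)$ be the product of the primes dividing $n$, and $\mathrm{ord}_m(u)$ the multiplicative order of $u$ modulo $m$. For $h=\sum_i a_iX^i\in\overline{\mathbb F}_q[X]$, the degree of the coefficients of $h$ is $\delta(h)=[\mathbb F_q(a_0,a_1,\ldots):\mathbb F_q]$, and the $q$-spin of $h$ is $\prod_{u=0}^{\delta(h)-1}\sum_i a_i^{q^u}X^i$. Let $f\in\mathbb F_q[X]$, $f\neq X$, be monic and irreducible of degree $k$, and let $\alpha\in\mathbb F_{q^k}^*$ be a root of $f$. Let $n$ be a positive integer with $\gcd(n,q)=1$, and write $n=n_1n_2$ with $\mathrm{rad}(n_1)\mid\mathrm{ord}(\alpha)$ and $\gcd(n_2,\mathrm{ord}(\alpha))=1$. Let $w=\mathrm{ord}_{\mathrm{rad}(n)}(q^k)$,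 and let $s=w$ if $4\nmid n$ or $q^{kw}\equiv1\pmod 4$, and $s=2w$ otherwise. For $t\ge1$ put $$d_1^{(t)}=\gcd\Big(n_1,\frac{q^{kt}-1}{\mathrm{ord}(\alpha)}\Big),\qquad d_2^{(t)}=\gcd(n_2,q^{kt}-1).$$ Let $s_1=d_1^{(s)}/d_1^{(1)}$ if $4\nmid d_1^{(s)}$ or $q^k\equiv1\pmod4$, and $s_1=2d_1^{(s)}/d_1^{(2)}$ otherwise. For an integer $i\ge0$ let $t_i$ be the least $t\ge1$ such that $i$ is an integer multiple of the rational number $d_2^{(s)}/d_2^{(t)}$, and let $c_i=\mathrm{lcm}(t_i,s_1)$. Let $\zeta_1,\zeta_2\in\overline{\mathbb F}_q$ be primitive roots of unity of orders $d_1^{(s)}$ and $d_2^{(s)}$ respectively. Then there exists $\beta\in\mathbb F_{q^{ks}}$ with $\beta^{d_1^{(s)}}=\alpha$, and there exists a positive integer $r$ such that $r=1$ if $f=X-1$, and $rn_2\equiv1\pmod{\mathrm{ord}(\alpha)\,d_1^{(s)}}$ otherwise. For any such $\beta$ and $r$ the following holds. On $\{0,\ldots,d_1^{(s)}-1\}$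 an equivalence relation is given by: $j\sim\tilde j$ if and only if $\zeta_1^{\tilde j}=\zeta_1^{jq^{km}}\beta^{q^{km}-1}$ for some integer $0\le m\le s_1-1$. Let $J$ be any complete set of representatives of $\sim$, and $I$ any complete set of (nonnegative integer) representatives of the $q^k$-cyclotomic cosets $\{iq^{kl}\bmod d_2^{(s)}: l\ge0\}$ modulo $d_2^{(s)}$. Then the factorization of $f(X^n)$ into monic irreducible polynomials over $\mathbb F_q$ is $$f(X^n)=\prod_{j\in J}\ \prod_{v\mid n_2/d_2^{(s)}}\ \prod_{\substack{i\in I\\ \gcd(i,v)=1}}\ \prod_{m=0}^{\gcd(t_i,s_1)-1}S_{(j,v,i,m)},$$ where, with $x=x_{(j,v,i,m)}=\zeta_2^{\,i q^{km}}(\zeta_1^{\,j}\beta)^{rv}$, $$S_{(j,v,i,m)}=\sum_{l=0}^{kc_i}X^{\frac{n_1}{d_1^{(s)}}vl}\,(-1)^{kc_i-l}\sum_{\substack{U\subseteq\{0,\ldots,kc_i-1\}\\|U|=kc_i-l}}\ \prod_{u\in U}x^{q^u}.$$ Each $S_{(j,v,i,m)}$ lies in $\mathbb F_q[X]$, is monic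 and irreducible over $\mathbb F_q$, has degree $k\cdot\frac{n_1}{d_1^{(s)}}\cdot v\cdot c_i$ and order $\mathrm{ord}(\alpha)\cdot n_1\cdot v\cdot\frac{d_2^{(s)}}{\gcd(i,d_2^{(s)})}$, and is the $q$-spin of the binomial $X^{\frac{n_1}{d_1^{(s)}}v}-x$, whose degree of the coefficients over $\mathbb F_q$ is $kc_i$. -/

import Mathlib

namespace PowerComp

open Polynomial

/-- `h^{(j)}`: every coefficient of `h` is raised to the power `q ^ j`. -/
noncomputable def twist {E : Type*} [Field E] (q j : ℕ) (h : E[X]) : E[X] :=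
  h.sum fun i a => monomial i (a ^ q ^ j)

/-- The degree over `F` of the field generated over `F` by the coefficients of `h`. -/
noncomputable def coeffDeg (F : Type*) {E : Type*} [Field F] [Field E] [Algebra F E]
    (h : E[X]) : ℕ :=
  Module.finrank F (IntermediateField.adjoin F (h.coeffs : Set E))

/-- The `q`-spin of `h`, where `q` is the number of elements of `F`: the product of the
`h^{(j)}`, where `j` runs from `0` to the degree of the coefficients of `h` minus `1`. -/
noncomputable def spin (F : Type*) {E : Type*} [Field F] [Field E] [Algebra F E]
    (h : E[X]) : E[X] :=
  ∏ j ∈ Finset.range (coeffDeg F h), twist (Nat.card F) j h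

/-- The order of a polynomial `g`: the least positive `e` such that `g ∣ X ^ e - 1`. -/
noncomputable def polyOrder {F : Type*} [Field F] (g : F[X]) : ℕ :=
  sInf {e : ℕ | 0 < e ∧ g ∣ X ^ e - 1}

/-- The multiplicative order of `Q` modulo the radical of `n`. -/
noncomputable def baseExt (Q n : ℕ) : ℕ :=
  orderOf (Q : ZMod (UniqueFactorizationMonoid.radical n))

open Classical in
/-- `s = w` if `4 ∤ n` or `Q ^ w ≡ 1 (mod 4)`, and `s = 2 w` otherwise, with
`w = baseExt Q n`. -/
noncomputable def extDeg (Q n : ℕ) : ℕ :=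
  if ¬ 4 ∣ n ∨ Q ^ baseExt Q n ≡ 1 [MOD 4] then baseExt Q n else 2 * baseExt Q n

/-- `d₁^{(t)} = gcd (n₁, (Q ^ t - 1) / e)`. -/
def dOne (Q e n₁ t : ℕ) : ℕ := Nat.gcd n₁ ((Q ^ t - 1) / e)

/-- `d₂^{(t)} = gcd (n₂, Q ^ t - 1)`. -/
def dTwo (Q n₂ t : ℕ) : ℕ := Nat.gcd n₂ (Q ^ t - 1)

open Classical in
/-- The number `s₁`. -/
noncomputable def sOne (Q e n₁ s : ℕ) : ℕ :=
  if ¬ 4 ∣ dOne Q e n₁ s ∨ Q ≡ 1 [MOD 4] then dOne Q e n₁ s / dOne Q e n₁ 1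
  else 2 * dOne Q e n₁ s / dOne Q e n₁ 2

/-- The number `t_i`: the least positive `t` such that the quotient
`d₂^{(s)} / d₂^{(t)}` divides `i`. The divisibility is written without the quotient, since
`d₂^{(t)}` need not divide `d₂^{(s)}` when `t` does not divide `s`. -/
noncomputable def tNum (Q n₂ s i : ℕ) : ℕ :=
  sInf {t : ℕ | 0 < t ∧ dTwo Q n₂ s ∣ i * dTwo Q n₂ t}

/-- The number `c_i = lcm (t_i, s₁)`. -/
noncomputable def cNum (Q e n₁ n₂ s i : ℕ) : ℕ :=
  Nat.lcm (tNum Q n₂ s i) (sOne Q e n₁ s)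

/-- The relation `j ∼ j'`, given by `ζ ^ j' = ζ ^ (j Q ^ m) β ^ (Q ^ m - 1)` for some
`0 ≤ m ≤ s₁ - 1`. -/
def expRel {E : Type*} [Field E] (Q s₁ : ℕ) (ζ β : E) (j j' : ℕ) : Prop :=
  ∃ m < s₁, ζ ^ j' = ζ ^ (j * Q ^ m) * β ^ (Q ^ m - 1)

/-- `J` is a complete set of representatives of `{0, …, d - 1}` modulo the relation `r`. -/
def IsRepSystem (d : ℕ) (r : ℕ → ℕ → Prop) (J : Finset ℕ) : Prop :=
  (∀ j ∈ J, j < d) ∧ ∀ a < d, ∃! j, j ∈ J ∧ r j a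

/-- The `Q`-cyclotomic coset of `i` modulo `d`, as a set of residues in `{0, …, d - 1}`. -/
def cycloCoset (Q d i : ℕ) : Set ℕ := {a | ∃ l : ℕ, a = i * Q ^ l % d}

/-- `I` is a complete set of representatives of the `Q`-cyclotomic cosets modulo `d`. -/
def IsCycloRepSystem (Q d : ℕ) (I : Finset ℕ) : Prop :=
  ∀ a < d, ∃! i, i ∈ I ∧ a ∈ cycloCoset Q d i

/-- The polynomial
`∑_{l=0}^{N} X^{T l} (-1)^{N-l} ∑_{U ⊆ {0,…,N-1}, |U| = N-l} ∏_{u ∈ U} x^{q^u}`. -/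
noncomputable def explicitPoly {E : Type*} [Field E] (q T N : ℕ) (x : E) : E[X] :=
  ∑ l ∈ Finset.range (N + 1), X ^ (T * l) *
    C ((-1) ^ (N - l) *
      ∑ U ∈ Finset.powersetCard (N - l) (Finset.range N), ∏ u ∈ U, x ^ q ^ u)

end PowerComp

/-! Write `e = ord(α)`, `Q = q ^ k`. Up to Frobenius a root `γ` of `f(X ^ n)` satisfies `γ ^ n = α`.
Then `b = γ ^ (n₁ / d₁ * n₂)` is a `d₁`-th root of `α`, so `b = ζ₁ ^ j * β`, and `b` has order `e *
d₁`. Since `r` inverts `n₂` modulo that order, `γ ^ (n₁ / d₁) / b ^ r` is an `n₂`-th root of unity;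
a suitable power `v` of it is `ζ₂ ^ i` with `gcd(i, v) = 1`. Hence `γ` is a root of `X ^ T - x` with
`T = n₁ / d₁ * v` and `x = ζ₂ ^ i * b ^ (r * v)` (`exists_index`).

The two factors of `x` have coprime orders `d₂ / gcd(i, d₂)` and `e * d₁`; their orbits under the
`Q`-power map have lengths `t i` and `s₁`, so `x` has degree `k * c i` over `F`. Because `d₁` and
`d₂` are gcds taken at level `s`, every prime `p ∣ T` divides `ord(x)` while `p * ord(x) ∤ Q ^ s -
1`, and `4 ∣ T` forces `4 ∣ ord(x)`. Lifting the exponent then gives `γ` degree `T * k * c i`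
(`natDegree_minpoly_eq_mul`, `root_facts`), so its minimal polynomial is the product of the
conjugates of `X ^ T - x`, which is the spin.

It remains to count Frobenius orbits (`index_unique`, `exists_index`): `J` handles `b`, `I` handles
the root of unity, and the diagonal shift on `ℤ/t_i × ℤ/s₁` has `gcd(t_i, s₁)` orbits, indexed by
`m`. As `f(X ^ n)` is separable, it is the product of the distinct minimal polynomials
(`eq_prod_minpoly`). -/

namespace PowerComp

open Polynomial

/-! ### Divisors of `Q ^ t - 1`, and the numbers `s`, `s₁`, `t_i`. -/

section Arithmetic

/-- Turns the minima defining `tNum` and `polyOrder` into orders; `o = 0` is covered by `sInf ∅ =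
0`, matching `orderOf` of an element of infinite order. -/
lemma sInf_pos_dvd (o : ℕ) : sInf {t : ℕ | 0 < t ∧ o ∣ t} = o := by
  rcases Nat.eq_zero_or_pos o with rfl | ho
  · have : {t : ℕ | 0 < t ∧ 0 ∣ t} = ∅ := by
      exact Set.eq_empty_of_forall_notMem fun t ht => ht.1.ne' (zero_dvd_iff.1 ht.2)
    rw [this, Nat.sInf_empty]
  · apply le_antisymm
    · exact Nat.sInf_le ⟨ho, dvd_rfl⟩
    · exact le_csInf ⟨o, ho, dvd_rfl⟩ fun t ht => Nat.le_of_dvd ht.1 ht.2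

lemma dvd_pow_sub_one_iff_modEq {d a : ℕ} (ha : 0 < a) (t : ℕ) :
    d ∣ a ^ t - 1 ↔ ((a : ZMod d)) ^ t = 1 := by
  rw [← Nat.modEq_iff_dvd' (Nat.one_le_pow _ _ ha), ← ZMod.natCast_eq_natCast_iff]
  push_cast
  exact eq_comm

lemma dvd_pow_sub_one_iff_orderOf {d a : ℕ} (ha : 0 < a) (t : ℕ) :
    d ∣ a ^ t - 1 ↔ orderOf (a : ZMod d) ∣ t := by
  rw [dvd_pow_sub_one_iff_modEq ha, orderOf_dvd_iff_pow_eq_one]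

lemma orderOf_natCast_pos {d a : ℕ} (hd : 0 < d) (h : a.Coprime d) :
    0 < orderOf (a : ZMod d) := by
  have : NeZero d := ⟨hd.ne'⟩
  rw [← ZMod.coe_unitOfCoprime a h, orderOf_units]
  exact orderOf_pos _

/-- The part of the lifting-the-exponent lemma for a single prime. -/
lemma emultiplicity_pow_sub_one {p Q t : ℕ} (hp : p.Prime) (h : p ∣ Q - 1) (hQ : 0 < Q)
    (h4 : p = 2 → 4 ∣ Q - 1) :
    emultiplicity p (Q ^ t - 1) = emultiplicity p (Q - 1) + emultiplicity p t := by
  have hpQ : ¬ p ∣ Q := fun h' => by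
    have := (Nat.dvd_sub_iff_right hQ h').1 h
    exact hp.one_lt.ne' (Nat.dvd_one.1 this)
  rcases hp.eq_two_or_odd' with rfl | hodd
  · have key := Int.two_pow_sub_pow' (x := Q) (y := 1) t
      (by have := h4 rfl; zify [hQ] at this; exact this)
      (by exact_mod_cast hpQ)
    rw [one_pow] at key
    have e1 : ((Q : ℤ) ^ t - 1) = ((Q ^ t - 1 : ℕ) : ℤ) := by
      rw [Nat.cast_sub (Nat.one_le_pow _ _ hQ)]; push_cast; rfl
    have e2 : ((Q : ℤ) - 1) = ((Q - 1 : ℕ) : ℤ) := by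
      rw [Nat.cast_sub hQ]; push_cast; rfl
    rw [e1, e2] at key
    have h2 : (2 : ℤ) = ((2 : ℕ) : ℤ) := rfl
    rw [h2, Int.natCast_emultiplicity, Int.natCast_emultiplicity,
      Int.natCast_emultiplicity] at key
    exact key
  · have := Nat.emultiplicity_pow_sub_pow hp hodd (x := Q) (y := 1) h hpQ t
    rwa [one_pow] at this

/-- Lifting the exponent with the finite contribution of `Q - 1` cancelled. It can fail for `p = 2`,
`Q ≡ 3` mod 4, but modulo `p` itself the sum is simply `t`. -/
lemma prime_pow_dvd_geom_sum_iff {p Q t a : ℕ} (hp : p.Prime) (h : p ∣ Q - 1) (hQ : 1 < Q)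
    (h4 : p ^ a = 2 ∨ (p = 2 → 4 ∣ Q - 1)) :
    p ^ a ∣ ∑ i ∈ Finset.range t, Q ^ i ↔ p ^ a ∣ t := by
  rcases h4 with h2 | h4
  · have hmod : ∑ i ∈ Finset.range t, Q ^ i ≡ t [MOD p] := by
      have h1 : Q ≡ 1 [MOD p] := ((Nat.modEq_iff_dvd' hQ.le).2 h).symm
      calc ∑ i ∈ Finset.range t, Q ^ i ≡ ∑ i ∈ Finset.range t, 1 [MOD p] := by
            rw [← ZMod.natCast_eq_natCast_iff] at h1 ⊢
            push_cast at h1 ⊢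
            simp [h1]
        _ = t := by simp
    have hpa : p ^ a = p := by
      have ha : a ≠ 0 := by rintro rfl; simp at h2
      have : p ∣ 2 := h2 ▸ dvd_pow_self p ha
      rw [h2]
      exact ((Nat.prime_dvd_prime_iff_eq hp Nat.prime_two).1 this).symm
    rw [hpa]
    exact hmod.dvd_iff dvd_rfl
  · have hfin : emultiplicity p (Q - 1) ≠ ⊤ :=
      finiteMultiplicity_iff_emultiplicity_ne_top.1
        (Nat.finiteMultiplicity_iff.2 ⟨hp.one_lt.ne', by omega⟩)
    have key := emultiplicity_pow_sub_one (t := t) hp h (by omega) h4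
    have hg : Q ^ t - 1 = (Q - 1) * ∑ i ∈ Finset.range t, Q ^ i := by
      have := Nat.geomSum_eq (m := Q) hQ t
      rw [this, Nat.mul_div_cancel']
      simpa using Nat.sub_dvd_pow_sub_pow Q 1 t
    rw [hg, emultiplicity_mul hp.prime] at key
    have := ENat.add_right_injective_of_ne_top hfin key
    rw [pow_dvd_iff_le_emultiplicity, pow_dvd_iff_le_emultiplicity, this]

lemma dvd_geom_sum_iff {d Q t : ℕ} (hQ : 1 < Q) (h : ∀ p, p.Prime → p ∣ d → p ∣ Q - 1)
    (h4 : ¬ 4 ∣ d ∨ 4 ∣ Q - 1) :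
    d ∣ ∑ i ∈ Finset.range t, Q ^ i ↔ d ∣ t := by
  have main : ∀ p a, p.Prime → p ^ a ∣ d →
      (p ^ a ∣ ∑ i ∈ Finset.range t, Q ^ i ↔ p ^ a ∣ t) := by
    intro p a hp hpa
    rcases Nat.eq_zero_or_pos a with rfl | ha
    · simp
    have hpd : p ∣ d := (dvd_pow_self p ha.ne').trans hpa
    apply prime_pow_dvd_geom_sum_iff hp (h p hp hpd) hQ
    rcases h4 with h4 | h4
    · by_cases hp2 : p = 2
      · subst hp2
        left
        have : a < 2 := by
          by_contra hcon
          exact h4 ((pow_dvd_pow 2 (not_lt.1 hcon)).trans hpa)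
        have : a = 1 := by omega
        simp [this]
      · right; intro h; exact absurd h hp2
    · exact Or.inr fun _ => h4
  rw [Nat.dvd_iff_prime_pow_dvd_dvd, Nat.dvd_iff_prime_pow_dvd_dvd]
  constructor
  · intro H p a hp hpa; exact (main p a hp hpa).1 (H p a hp hpa)
  · intro H p a hp hpa; exact (main p a hp hpa).2 (H p a hp hpa)

/-- With `a = (Q - 1) / e`, `Q ^ t - 1` is `e * a` times a geometric sum. Cancelling `e` and `gcd(d,
a)` leaves a divisor coprime to the rest of `a`, which must divide the sum. -/
lemma mul_dvd_pow_sub_one_iff {e d Q t : ℕ} (hQ : 1 < Q) (he : e ∣ Q - 1)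
    (h : ∀ p, p.Prime → p ∣ d → p ∣ e) (h4 : ¬ 4 ∣ d ∨ 4 ∣ Q - 1) :
    e * d ∣ Q ^ t - 1 ↔ d / Nat.gcd d ((Q - 1) / e) ∣ t := by
  obtain ⟨a, ha⟩ := he
  have he0 : 0 < e := Nat.pos_of_ne_zero (by rintro rfl; omega)
  have ha0 : 0 < a := Nat.pos_of_ne_zero (by rintro rfl; omega)
  have hg : Q ^ t - 1 = e * (a * ∑ i ∈ Finset.range t, Q ^ i) := by
    rw [← mul_assoc, ← ha, Nat.geomSum_eq hQ t, Nat.mul_div_cancel']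
    simpa using Nat.sub_dvd_pow_sub_pow Q 1 t
  have hgd : Nat.gcd d a ∣ d := Nat.gcd_dvd_left _ _
  have hdd : d / Nat.gcd d a ∣ d := Nat.div_dvd_of_dvd hgd
  rw [hg, Nat.mul_dvd_mul_iff_left he0, ha, Nat.mul_div_cancel_left _ he0,
    ← dvd_geom_sum_iff hQ (fun p hp hpd => ha ▸ Dvd.dvd.mul_right (h p hp (hpd.trans hdd)) a)
      (h4.imp (fun h' h'' => h' (h''.trans hdd)) id)]
  have hgp : 0 < Nat.gcd d a := Nat.gcd_pos_of_pos_right _ ha0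
  have hco := Nat.coprime_div_gcd_div_gcd hgp
  constructor
  · intro H
    refine hco.dvd_of_dvd_mul_left ?_
    rw [← Nat.mul_dvd_mul_iff_left hgp, ← mul_assoc, Nat.mul_div_cancel' hgd,
      Nat.mul_div_cancel' (Nat.gcd_dvd_right d a)]
    exact H
  · intro H
    calc d = Nat.gcd d a * (d / Nat.gcd d a) := (Nat.mul_div_cancel' hgd).symm
      _ ∣ _ := mul_dvd_mul (Nat.gcd_dvd_right d a) H

lemma extDeg_facts {Q n : ℕ} (hQ : 1 < Q) (hn : 0 < n) (h : n.Coprime Q) :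
    0 < extDeg Q n ∧ (∀ p, p.Prime → p ∣ n → p ∣ Q ^ extDeg Q n - 1) ∧
      (4 ∣ n → 4 ∣ Q ^ extDeg Q n - 1) := by
  have hrad : UniqueFactorizationMonoid.radical n ∣ n :=
    UniqueFactorizationMonoid.radical_dvd_self
  have hw : 0 < baseExt Q n :=
    orderOf_natCast_pos (Nat.radical_pos n) (h.symm.coprime_dvd_right hrad)
  have hwd : ∀ s, baseExt Q n ∣ s → ∀ p, p.Prime → p ∣ n → p ∣ Q ^ s - 1 := by
    intro s hs p hp hpn
    have : p ∣ UniqueFactorizationMonoid.radical n :=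
      (UniqueFactorizationMonoid.dvd_radical_iff_of_irreducible hp hn.ne').2 hpn
    exact this.trans ((dvd_pow_sub_one_iff_orderOf (by omega) s).2 hs)
  unfold extDeg
  split_ifs with hc
  · refine ⟨hw, hwd _ dvd_rfl, fun h4 => ?_⟩
    have := hc.resolve_left (not_not.2 h4)
    exact (Nat.modEq_iff_dvd' (Nat.one_le_pow _ _ (by omega))).1 this.symm
  · refine ⟨by omega, hwd _ (dvd_mul_left _ _), fun h4 => ?_⟩
    -- Doubling the exponent suffices because an odd square is 1 modulo 8.
    have h2 : Odd (Q ^ baseExt Q n) := by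
      apply Odd.pow
      rw [← Nat.not_even_iff_odd, even_iff_two_dvd]
      intro h2
      have := Nat.dvd_gcd ((by norm_num : 2 ∣ 4).trans h4) h2
      rw [h] at this
      omega
    have h8 := Nat.eight_dvd_sq_sub_one_of_odd h2
    rw [← pow_mul, mul_comm] at h8
    exact (by norm_num : 4 ∣ 8).trans h8

/-- In the exceptional case `Q ≡ 3` mod 4 and `4 ∣ d₁`, so only even `t` can occur; passing to `Q ^
2 ≡ 1` mod 4 explains the factor 2 and `d₁^{(2)}` in `s₁`. -/
lemma mul_dOne_dvd_iff {Q e n₁ s t : ℕ} (hQ : 1 < Q) (he : e ∣ Q - 1)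
    (h : ∀ p, p.Prime → p ∣ n₁ → p ∣ e) :
    e * dOne Q e n₁ s ∣ Q ^ t - 1 ↔ sOne Q e n₁ s ∣ t := by
  classical
  have he0 : 0 < e := Nat.pos_of_ne_zero (by rintro rfl; simp at he; omega)
  have hp : ∀ p, p.Prime → p ∣ dOne Q e n₁ s → p ∣ e :=
    fun p hp hpd => h p hp (hpd.trans (Nat.gcd_dvd_left _ _))
  have hsub : ∀ {m l : ℕ}, m ∣ l → Q ^ m - 1 ∣ Q ^ l - 1 :=
    fun h => Nat.pow_sub_one_dvd_pow_sub_one Q h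
  have hgcd : ∀ {m}, m ∣ s → Nat.gcd (dOne Q e n₁ s) ((Q ^ m - 1) / e) = dOne Q e n₁ m := by
    intro m hm
    have he' : e ∣ Q ^ m - 1 := he.trans (by simpa using hsub (one_dvd m))
    have h1 : (Q ^ m - 1) / e ∣ (Q ^ s - 1) / e := Nat.div_dvd_div he' (hsub hm)
    rw [dOne, dOne, Nat.gcd_assoc, Nat.gcd_eq_right h1]
  unfold sOne
  split_ifs with hc
  · rw [mul_dvd_pow_sub_one_iff hQ he hp
      (hc.imp id fun h => (Nat.modEq_iff_dvd' hQ.le).1 h.symm)]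
    have := hgcd (one_dvd s)
    rw [pow_one] at this
    rw [this]
  · push Not at hc
    obtain ⟨h4, hQ4⟩ := hc
    have h2e : 2 ∣ e := hp 2 Nat.prime_two ((by norm_num : 2 ∣ 4).trans h4)
    have hQodd : Odd Q := by
      have := h2e.trans he
      rw [Nat.odd_iff]; omega
    have hQ3 : Q % 4 = 3 := by
      rw [Nat.odd_iff] at hQodd
      unfold Nat.ModEq at hQ4
      omega
    have heven : ∀ l, 4 ∣ Q ^ l - 1 → 2 ∣ l := by
      intro l hl
      rw [← even_iff_two_dvd]
      by_contra hodd
      rw [Nat.not_even_iff_odd] at hodd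
      obtain ⟨m, rfl⟩ := hodd
      have h1 : Q ^ (2 * m + 1) % 4 = 3 := by
        rw [pow_succ, pow_mul, Nat.mul_mod, Nat.pow_mod (Q ^ 2), Nat.pow_mod Q, hQ3]
        norm_num
      have := Nat.one_le_pow (2 * m + 1) Q (by omega)
      omega
    have hes : e ∣ Q ^ s - 1 := he.trans (by simpa using hsub (one_dvd s))
    have hd4 : dOne Q e n₁ s ∣ Q ^ s - 1 :=
      (Nat.gcd_dvd_right _ _).trans (Nat.div_dvd_of_dvd hes)
    have h2s : 2 ∣ s := heven s (h4.trans hd4)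
    have he2 : e ∣ Q ^ 2 - 1 := he.trans (by simpa using hsub (one_dvd 2))
    have h42 : 4 ∣ Q ^ 2 - 1 :=
      (by norm_num : 4 ∣ 8).trans (Nat.eight_dvd_sq_sub_one_of_odd hQodd)
    have hQ2 : 1 < Q ^ 2 := Nat.one_lt_pow (by norm_num) hQ
    have hdd : dOne Q e n₁ 2 ∣ dOne Q e n₁ s := by
      rw [← hgcd h2s]; exact Nat.gcd_dvd_left _ _
    rw [Nat.mul_div_assoc _ hdd]
    have key : ∀ l, e * dOne Q e n₁ s ∣ Q ^ (2 * l) - 1 ↔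
        dOne Q e n₁ s / dOne Q e n₁ 2 ∣ l := by
      intro l
      rw [pow_mul, mul_dvd_pow_sub_one_iff hQ2 he2 hp (Or.inr h42), hgcd h2s]
    constructor
    · intro H
      obtain ⟨l, rfl⟩ := heven t ((h4.trans (dvd_mul_left _ _)).trans H)
      exact mul_dvd_mul_left 2 ((key l).1 H)
    · intro H
      obtain ⟨l, rfl⟩ := (dvd_mul_right 2 _).trans H
      exact (key l).2 ((Nat.mul_dvd_mul_iff_left two_pos).1 H)

lemma dvd_mul_iff_div_gcd_dvd {d i m : ℕ} (hd : 0 < d) :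
    d ∣ i * m ↔ d / Nat.gcd i d ∣ m := by
  have hg : 0 < Nat.gcd i d := Nat.gcd_pos_of_pos_right _ hd
  constructor
  · intro h
    refine (Nat.coprime_div_gcd_div_gcd hg).symm.dvd_of_dvd_mul_left ?_
    rw [← Nat.mul_dvd_mul_iff_left hg, ← mul_assoc, Nat.mul_div_cancel' (Nat.gcd_dvd_right i d),
      Nat.mul_div_cancel' (Nat.gcd_dvd_left i d)]
    exact h
  · intro h
    calc d = Nat.gcd i d * (d / Nat.gcd i d) := (Nat.mul_div_cancel' (Nat.gcd_dvd_right i d)).symm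
      _ ∣ _ := mul_dvd_mul (Nat.gcd_dvd_left i d) h

/-- `D = d₂ / gcd(i, d₂)` divides `n₂`, so dividing `gcd(n₂, Q ^ t - 1)` and dividing `Q ^ t - 1`
agree: `t_i` is the order of `Q` modulo `D`. -/
lemma dvd_tNum_iff {Q n₂ s i : ℕ} (hQ : 0 < Q) (hn₂ : 0 < n₂) (t : ℕ) :
    dTwo Q n₂ s / Nat.gcd i (dTwo Q n₂ s) ∣ Q ^ t - 1 ↔ tNum Q n₂ s i ∣ t := by
  have hd : 0 < dTwo Q n₂ s := Nat.gcd_pos_of_pos_left _ hn₂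
  set D := dTwo Q n₂ s / Nat.gcd i (dTwo Q n₂ s) with hD
  have hDn : D ∣ n₂ :=
    (Nat.div_dvd_of_dvd (Nat.gcd_dvd_right _ _)).trans (Nat.gcd_dvd_left _ _)
  have : tNum Q n₂ s i = orderOf (Q : ZMod D) := by
    unfold tNum
    rw [← sInf_pos_dvd (orderOf (Q : ZMod D))]
    congr 1
    ext t
    simp only [Set.mem_ofPred_eq]
    rw [dvd_mul_iff_div_gcd_dvd hd, ← hD, ← dvd_pow_sub_one_iff_orderOf hQ, dTwo,
      Nat.dvd_gcd_iff, and_iff_right hDn]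
  rw [this, dvd_pow_sub_one_iff_orderOf hQ]

end Arithmetic

/-! ### Orders of `T`-th roots. -/

section OrderOf

variable {G : Type*}

/-- `T / gcd(ord γ, T)` is coprime to `M`, yet each of its primes divides `M`; hence it is 1 and `T
∣ ord γ`. -/
lemma orderOf_eq_mul_of_pow [Monoid G] {γ : G} {T M : ℕ} (hT : 0 < T)
    (hM : orderOf (γ ^ T) = M) (hp : ∀ p, p.Prime → p ∣ T → p ∣ M) : orderOf γ = T * M := by
  rw [orderOf_pow' γ hT.ne'] at hM
  have hg : 0 < Nat.gcd (orderOf γ) T := Nat.gcd_pos_of_pos_right _ hT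
  have hco := Nat.coprime_div_gcd_div_gcd hg
  rw [hM] at hco
  have h1 : T / Nat.gcd (orderOf γ) T = 1 := by
    by_contra hne
    obtain ⟨p, hpp, hpd⟩ := Nat.exists_prime_and_dvd hne
    have hpT : p ∣ T := hpd.trans (Nat.div_dvd_of_dvd (Nat.gcd_dvd_right _ _))
    have := Nat.dvd_gcd (hp p hpp hpT) hpd
    rw [hco] at this
    exact hpp.one_lt.ne' (Nat.dvd_one.1 this)
  have hT' : Nat.gcd (orderOf γ) T = T := by
    have := Nat.div_mul_cancel (Nat.gcd_dvd_right (orderOf γ) T)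
    rwa [h1, one_mul] at this
  rw [hT'] at hM
  rw [← hM, Nat.mul_div_cancel' (hT' ▸ Nat.gcd_dvd_left _ _)]

lemma pow_eq_self_iff_orderOf_dvd [Field G] {γ : G} (hγ : γ ≠ 0) {N : ℕ} (hN : 0 < N) :
    γ ^ N = γ ↔ orderOf γ ∣ N - 1 := by
  rw [orderOf_dvd_iff_pow_eq_one]
  obtain ⟨N, rfl⟩ : ∃ M, N = M + 1 := ⟨N - 1, by omega⟩
  rw [pow_succ, Nat.add_sub_cancel]
  exact ⟨fun h => mul_right_cancel₀ hγ (by rw [h, one_mul]), fun h => by rw [h, one_mul]⟩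

end OrderOf

/-! ### Frobenius conjugates, degrees and spins over a finite field. -/

section FiniteField

variable {F E : Type*} [Field F] [Finite F] [Field E] [Algebra F E]

variable (F E) in
lemma exists_algHom_eq_pow_card_pow (u : ℕ) :
    ∃ φ : E →ₐ[F] E, ∀ x, φ x = x ^ Nat.card F ^ u := by
  cases nonempty_fintype F
  refine ⟨FiniteField.frobeniusAlgHom F E ^ u, fun x => ?_⟩
  rw [Nat.card_eq_fintype_card]
  induction u generalizing x with
  | zero => simp
  | succ u ih => rw [pow_succ, AlgHom.mul_apply, ih, FiniteField.coe_frobeniusAlgHom, ← pow_mul,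
      pow_succ' (Fintype.card F)]

variable (F) in
lemma pow_card_pow_injective (u : ℕ) : Function.Injective fun x : E => x ^ Nat.card F ^ u := by
  obtain ⟨φ, hφ⟩ := exists_algHom_eq_pow_card_pow F E u
  simp only [← hφ]
  exact φ.injective

variable (F) in
lemma pow_card_pow_eq_pow_card_pow_iff {P : ℕ} (K : ℕ) {γ : E}
    (h : ∀ u, γ ^ (Nat.card F ^ K) ^ u = γ ↔ P ∣ u) (a b : ℕ) :
    γ ^ (Nat.card F ^ K) ^ a = γ ^ (Nat.card F ^ K) ^ b ↔ a ≡ b [MOD P] := by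
  wlog hab : a ≤ b generalizing a b
  · rw [eq_comm, this b a (by omega)]; exact ⟨Nat.ModEq.symm, Nat.ModEq.symm⟩
  obtain ⟨c, rfl⟩ := Nat.exists_eq_add_of_le hab
  rw [Nat.modEq_iff_dvd' hab, Nat.add_sub_cancel_left, ← h c, pow_add, mul_comm, pow_mul,
    ← pow_mul (Nat.card F) K a]
  rw [(pow_card_pow_injective F (K * a)).eq_iff]
  exact eq_comm

variable [Algebra.IsAlgebraic F E]

/-- The Frobenius of `F(γ)` has order `[F(γ) : F]`, and a power of it is the identity exactly when
it fixes `γ`. -/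
lemma pow_card_pow_eq_self_iff (γ : E) (u : ℕ) :
    γ ^ Nat.card F ^ u = γ ↔ (minpoly F γ).natDegree ∣ u := by
  cases nonempty_fintype F
  have hint : IsIntegral F γ := Algebra.IsIntegral.isIntegral γ
  have : FiniteDimensional F (IntermediateField.adjoin F {γ}) :=
    IntermediateField.adjoin.finiteDimensional hint
  have : Finite (IntermediateField.adjoin F {γ}) := Module.finite_of_finite F
  rw [← IntermediateField.adjoin.finrank hint, ← FiniteField.orderOf_frobeniusAlgHom,
    orderOf_dvd_iff_pow_eq_one]
  have hfr : ∀ x : IntermediateField.adjoin F {γ},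
      (FiniteField.frobeniusAlgHom F (IntermediateField.adjoin F {γ}) ^ u) x
        = x ^ Nat.card F ^ u := by
    intro x
    rw [Nat.card_eq_fintype_card]
    induction u generalizing x with
    | zero => simp
    | succ u ih => rw [pow_succ, AlgHom.mul_apply, ih, FiniteField.coe_frobeniusAlgHom, ← pow_mul,
        pow_succ' (Fintype.card F)]
  constructor
  · intro h
    refine IntermediateField.algHom_ext_of_eq_adjoin F rfl fun x hx => ?_
    rw [hfr]
    obtain rfl := Set.mem_singleton_iff.1 hx
    exact Subtype.ext h
  · intro h
    have := hfr (IntermediateField.AdjoinSimple.gen F γ)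
    rw [h] at this
    simpa using (congrArg Subtype.val this).symm

omit [Finite F] in
lemma natDegree_minpoly_pos (γ : E) : 0 < (minpoly F γ).natDegree :=
  minpoly.natDegree_pos (Algebra.IsIntegral.isIntegral γ)

lemma orderOf_dvd_card_pow_sub_one_iff {γ : E} (hγ : γ ≠ 0) (u : ℕ) :
    orderOf γ ∣ Nat.card F ^ u - 1 ↔ (minpoly F γ).natDegree ∣ u := by
  rw [← pow_card_pow_eq_self_iff γ u,
    pow_eq_self_iff_orderOf_dvd hγ (Nat.pow_pos Nat.card_pos)]

lemma orderOf_pos_of_ne_zero (F : Type*) {E : Type*} [Field F] [Finite F] [Field E]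
    [Algebra F E] [Algebra.IsAlgebraic F E] {γ : E} (hγ : γ ≠ 0) : 0 < orderOf γ := by
  have h := (orderOf_dvd_card_pow_sub_one_iff (F := F) hγ _).2 dvd_rfl
  refine Nat.pos_of_dvd_of_pos h (Nat.sub_pos_of_lt ?_)
  exact Nat.one_lt_pow (natDegree_minpoly_pos γ).ne' Finite.one_lt_card

lemma pow_card_pow_eq_iff_modEq (γ : E) (a b : ℕ) :
    γ ^ Nat.card F ^ a = γ ^ Nat.card F ^ b ↔ a ≡ b [MOD (minpoly F γ).natDegree] := by
  have := pow_card_pow_eq_pow_card_pow_iff F 1 (P := (minpoly F γ).natDegree) (γ := γ)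
    (by simpa using pow_card_pow_eq_self_iff γ) a b
  simpa using this

omit [Algebra.IsAlgebraic F E] in
lemma minpoly_pow_card_pow (γ : E) (u : ℕ) : minpoly F (γ ^ Nat.card F ^ u) = minpoly F γ := by
  obtain ⟨φ, hφ⟩ := exists_algHom_eq_pow_card_pow F E u
  rw [← hφ, minpoly.algHom_eq φ φ.injective]

lemma map_minpoly_eq_prod (γ : E) :
    (minpoly F γ).map (algebraMap F E) =
      ∏ u ∈ Finset.range (minpoly F γ).natDegree, (X - C (γ ^ Nat.card F ^ u)) := by
  have hint : IsIntegral F γ := Algebra.IsIntegral.isIntegral γ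
  have hmon : ∀ u ∈ Finset.range (minpoly F γ).natDegree,
      (X - C (γ ^ Nat.card F ^ u) : E[X]).Monic := fun u _ => monic_X_sub_C _
  refine Polynomial.eq_of_monic_of_dvd_of_natDegree_le (monic_prod_of_monic _ _ hmon)
    ((minpoly.monic hint).map _) ?_ ?_
  · apply Finset.prod_dvd_of_coprime
    · intro a ha b hb hab
      refine isCoprime_X_sub_C_of_isUnit_sub (Ne.isUnit (sub_ne_zero.2 fun h => hab ?_))
      rw [pow_card_pow_eq_iff_modEq] at h
      exact h.eq_of_lt_of_lt (Finset.mem_range.1 ha) (Finset.mem_range.1 hb)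
    · intro u _
      rw [dvd_iff_isRoot, IsRoot, eval_map_algebraMap, ← minpoly_pow_card_pow γ u, minpoly.aeval]
  · rw [natDegree_map, natDegree_prod_of_monic _ _ hmon]
    simp only [natDegree_X_sub_C, Finset.sum_const, Finset.card_range, smul_eq_mul, mul_one, le_refl]

lemma minpoly_eq_iff (γ δ : E) :
    minpoly F γ = minpoly F δ ↔ ∃ u, γ = δ ^ Nat.card F ^ u := by
  constructor
  · intro h
    have h1 : eval γ ((minpoly F δ).map (algebraMap F E)) = 0 := by
      rw [eval_map_algebraMap, ← h, minpoly.aeval]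
    rw [map_minpoly_eq_prod, eval_prod, Finset.prod_eq_zero_iff] at h1
    obtain ⟨u, -, hu⟩ := h1
    exact ⟨u, by simpa [sub_eq_zero] using hu⟩
  · rintro ⟨u, rfl⟩
    exact minpoly_pow_card_pow δ u

/-- The minimal polynomial of `γ` as a product of conjugate binomials. -/
lemma map_minpoly_eq_prod_binomial {γ : E} {T N : ℕ} (hT : 0 < T)
    (hN : N = (minpoly F (γ ^ T)).natDegree) (hdeg : (minpoly F γ).natDegree = T * N) :
    (minpoly F γ).map (algebraMap F E) =
      ∏ u ∈ Finset.range N, (X ^ T - C ((γ ^ T) ^ Nat.card F ^ u)) := by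
  have hNpos : 0 < N := hN ▸ natDegree_minpoly_pos _
  have hint : IsIntegral F γ := Algebra.IsIntegral.isIntegral γ
  have hmon : ∀ u ∈ Finset.range N, (X ^ T - C ((γ ^ T) ^ Nat.card F ^ u) : E[X]).Monic :=
    fun u _ => monic_X_pow_sub_C _ hT.ne'
  refine (Polynomial.eq_of_monic_of_dvd_of_natDegree_le ((minpoly.monic hint).map _)
    (monic_prod_of_monic _ _ hmon) ?_ ?_).symm
  · rw [map_minpoly_eq_prod]
    apply Finset.prod_dvd_of_coprime
    · intro a ha b hb hab
      refine isCoprime_X_sub_C_of_isUnit_sub (Ne.isUnit (sub_ne_zero.2 fun h => hab ?_))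
      rw [pow_card_pow_eq_iff_modEq] at h
      exact h.eq_of_lt_of_lt (Finset.mem_range.1 ha) (Finset.mem_range.1 hb)
    -- Each conjugate of `γ` is a root of the binomial with index `u % N`; equality follows by
    -- comparing degrees.
    · intro u _
      refine Dvd.dvd.trans ?_ (Finset.dvd_prod_of_mem _
        (Finset.mem_range.2 (Nat.mod_lt u hNpos)))
      have : (γ ^ T) ^ Nat.card F ^ (u % N) = (γ ^ Nat.card F ^ u) ^ T := by
        rw [← pow_mul γ (Nat.card F ^ u), mul_comm (Nat.card F ^ u), pow_mul,
          pow_card_pow_eq_iff_modEq, ← hN]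
        exact Nat.mod_modEq u N
      rw [this, dvd_iff_isRoot]
      simp
  · rw [natDegree_map, hdeg, natDegree_prod_of_monic _ _ hmon]
    simp only [natDegree_X_pow_sub_C, Finset.sum_const, Finset.card_range, smul_eq_mul]
    rw [mul_comm]

/-- When the degree is maximal, all `T`-th roots of all conjugates of `γ ^ T` are conjugate to `γ`.
-/
lemma minpoly_eq_of_pow_eq {γ δ : E} {T N u : ℕ} (hT : 0 < T)
    (hN : N = (minpoly F (γ ^ T)).natDegree) (hdeg : (minpoly F γ).natDegree = T * N)
    (h : δ ^ T = (γ ^ T) ^ Nat.card F ^ u) : minpoly F δ = minpoly F γ := by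
  have hNpos : 0 < N := hN ▸ natDegree_minpoly_pos _
  refine (minpoly.eq_of_irreducible_of_monic
    (minpoly.irreducible (Algebra.IsIntegral.isIntegral γ)) ?_
    (minpoly.monic (Algebra.IsIntegral.isIntegral γ))).symm
  rw [← eval_map_algebraMap, map_minpoly_eq_prod_binomial hT hN hdeg, eval_prod]
  refine Finset.prod_eq_zero (Finset.mem_range.2 (Nat.mod_lt u hNpos)) ?_
  have : (γ ^ T) ^ Nat.card F ^ (u % N) = (γ ^ T) ^ Nat.card F ^ u := by
    rw [pow_card_pow_eq_iff_modEq, ← hN]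
    exact Nat.mod_modEq u N
  simp [this, h]

/-- The degree over `F` of a `T`-th root of `x`, if the order of `x` is large enough. -/
lemma natDegree_minpoly_eq_mul {γ : E} (hγ : γ ≠ 0) {T N M : ℕ} (hT : 0 < T)
    (hM : M = orderOf (γ ^ T)) (hN : N = (minpoly F (γ ^ T)).natDegree)
    (hp : ∀ p, p.Prime → p ∣ T → p ∣ M)
    (hco : ∀ p, p.Prime → p ∣ T → ¬ p * M ∣ Nat.card F ^ N - 1)
    (h4 : ¬ 4 ∣ T ∨ 4 ∣ Nat.card F ^ N - 1) :
    (minpoly F γ).natDegree = T * N := by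
  have hx : γ ^ T ≠ 0 := pow_ne_zero _ hγ
  have hNpos : 0 < N := hN ▸ natDegree_minpoly_pos _
  have hMN : ∀ u, M ∣ Nat.card F ^ u - 1 ↔ N ∣ u := by
    intro u; rw [hM, hN]; exact orderOf_dvd_card_pow_sub_one_iff hx u
  have hR : 1 < Nat.card F ^ N := Nat.one_lt_pow hNpos.ne' Finite.one_lt_card
  have hM0 : 0 < M := hM ▸ orderOf_pos_of_ne_zero F hx
  have hMR := (hMN N).2 dvd_rfl
  -- By `hco` no prime of `T` divides `(q ^ N - 1) / M`, so the divisor in `mul_dvd_pow_sub_one_iff`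
  -- is all of `T`.
  have hgcd : Nat.gcd T ((Nat.card F ^ N - 1) / M) = 1 := by
    apply Nat.coprime_of_dvd
    intro p hpp hpT hpd
    apply hco p hpp hpT
    rw [mul_comm]
    calc M * p ∣ M * ((Nat.card F ^ N - 1) / M) := mul_dvd_mul_left _ hpd
      _ = _ := Nat.mul_div_cancel' hMR
  have key : ∀ u, (minpoly F γ).natDegree ∣ u ↔ T * N ∣ u := by
    intro u
    rw [← orderOf_dvd_card_pow_sub_one_iff hγ, orderOf_eq_mul_of_pow hT hM.symm hp]
    have h1 : ∀ l, T * M ∣ Nat.card F ^ (N * l) - 1 ↔ T ∣ l := by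
      intro l
      rw [pow_mul, mul_comm T M, mul_dvd_pow_sub_one_iff hR hMR hp h4, hgcd, Nat.div_one]
    constructor
    · intro h
      obtain ⟨l, rfl⟩ := (hMN u).1 ((dvd_mul_left M T).trans h)
      rw [mul_comm T N]
      exact mul_dvd_mul_left N ((h1 l).1 h)
    · intro h
      obtain ⟨l, rfl⟩ := (dvd_mul_left N T).trans h
      rw [mul_comm T N, Nat.mul_dvd_mul_iff_left hNpos] at h
      exact (h1 l).2 h
  exact Nat.dvd_antisymm ((key _).2 dvd_rfl) ((key _).1 dvd_rfl)

omit [Finite F] [Algebra.IsAlgebraic F E] in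
lemma polyOrder_minpoly (γ : E) : polyOrder (minpoly F γ) = orderOf γ := by
  rw [polyOrder, ← sInf_pos_dvd (orderOf γ)]
  congr 1
  ext e
  simp only [Set.mem_ofPred_eq]
  rw [minpoly.dvd_iff, orderOf_dvd_iff_pow_eq_one]
  simp [sub_eq_zero]

omit [Finite F] [Algebra.IsAlgebraic F E] in
lemma adjoin_coeffs_binomial {T : ℕ} (hT : 0 < T) (x : E) :
    IntermediateField.adjoin F ((X ^ T - C x : E[X]).coeffs : Set E) =
      IntermediateField.adjoin F {x} := by
  apply le_antisymm
  · rw [IntermediateField.adjoin_le_iff]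
    intro c hc
    rw [Finset.mem_coe, mem_coeffs_iff] at hc
    obtain ⟨m, -, rfl⟩ := hc
    rw [coeff_sub, coeff_X_pow, coeff_C]
    refine sub_mem ?_ ?_
    · split_ifs
      exacts [one_mem _, zero_mem _]
    · split_ifs
      exacts [IntermediateField.mem_adjoin_simple_self F x, zero_mem _]
  · rw [IntermediateField.adjoin_simple_le_iff]
    -- `coeffs` records only nonzero coefficients, so the constant term is unavailable when `x = 0`.
    by_cases hx : x = 0
    · rw [hx]; exact zero_mem _
    · have h0 : (X ^ T - C x : E[X]).coeff 0 = -x := by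
        simp [coeff_X_pow, hT.ne]
      rw [← neg_mem_iff, ← h0]
      refine IntermediateField.subset_adjoin _ _ (coeff_mem_coeffs ?_)
      rw [h0]; exact neg_ne_zero.2 hx

omit [Finite F] in
lemma coeffDeg_binomial {T : ℕ} (hT : 0 < T) (x : E) :
    coeffDeg F (X ^ T - C x) = (minpoly F x).natDegree := by
  rw [coeffDeg, adjoin_coeffs_binomial hT,
    IntermediateField.adjoin.finrank (Algebra.IsIntegral.isIntegral x)]

omit [Algebra.IsAlgebraic F E] in
variable (F) in
lemma twist_binomial (j T : ℕ) (x : E) :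
    twist (Nat.card F) j (X ^ T - C x) = X ^ T - C (x ^ Nat.card F ^ j) := by
  obtain ⟨φ, hφ⟩ := exists_algHom_eq_pow_card_pow F E j
  have : ∀ h : E[X], twist (Nat.card F) j h = h.map (φ : E →+* E) := by
    intro h
    rw [twist, Polynomial.map, eval₂_eq_sum]
    simp [← C_mul_X_pow_eq_monomial, hφ]
  rw [this]
  simp [hφ]

lemma spin_binomial {T : ℕ} (hT : 0 < T) (x : E) :
    spin F (X ^ T - C x) = ∏ u ∈ Finset.range (minpoly F x).natDegree,
      (X ^ T - C (x ^ Nat.card F ^ u)) := by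
  rw [spin, coeffDeg_binomial hT]
  exact Finset.prod_congr rfl fun u _ => twist_binomial F u T x

end FiniteField

lemma prod_binomial_eq_explicitPoly {E : Type*} [Field E] (q T N : ℕ) (x : E) :
    ∏ u ∈ Finset.range N, (X ^ T - C (x ^ q ^ u)) = explicitPoly q T N x := by
  rw [explicitPoly]
  have h1 : ∀ u, (X ^ T - C (x ^ q ^ u) : E[X]) = -C (x ^ q ^ u) + X ^ T := fun u => by ring
  simp_rw [h1]
  -- `U` is the set of factors contributing their constant term; reflection replaces `|U|` by the
  -- number `l` of factors contributing `X ^ T`.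
  rw [Finset.prod_add, Finset.sum_powerset, Finset.card_range, ← Finset.sum_range_reflect]
  refine Finset.sum_congr rfl fun l hl => ?_
  have hl' : l ≤ N := Nat.lt_succ_iff.1 (Finset.mem_range.1 hl)
  rw [Nat.add_sub_cancel, C_mul, map_sum, Finset.mul_sum, Finset.mul_sum]
  refine Finset.sum_congr rfl fun U hU => ?_
  rw [Finset.mem_powersetCard] at hU
  rw [Finset.prod_const, Finset.card_sdiff_of_subset hU.1, Finset.card_range, hU.2,
    Nat.sub_sub_self hl', Finset.prod_neg, hU.2, map_prod]
  simp only [map_pow, map_neg, map_one]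
  ring

/-! ### Separable polynomials as products of minimal polynomials. -/

section Product

variable {F E : Type*} [Field F] [Field E] [Algebra F E] [IsAlgClosed E]
  [Algebra.IsAlgebraic F E]

/-- A monic separable polynomial is the product of the minimal polynomials of representatives
of its roots. -/
lemma eq_prod_minpoly {ι : Type*} {s : Finset ι} {g : ι → E} {G : F[X]} (hG : G.Monic)
    (hsep : G.Separable) (hroot : ∀ a ∈ s, aeval (g a) G = 0)
    (hinj : ∀ a ∈ s, ∀ b ∈ s, minpoly F (g a) = minpoly F (g b) → a = b)
    (hsurj : ∀ γ : E, aeval γ G = 0 → ∃ a ∈ s, minpoly F γ = minpoly F (g a)) :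
    G = ∏ a ∈ s, minpoly F (g a) := by
  have hint : ∀ x : E, IsIntegral F x := fun x => Algebra.IsIntegral.isIntegral x
  have hPmon : (∏ a ∈ s, minpoly F (g a)).Monic :=
    monic_prod_of_monic _ _ fun a _ => minpoly.monic (hint _)
  refine eq_of_monic_of_associated hG hPmon (associated_of_dvd_dvd ?_ ?_)
  · rw [← map_dvd_map' (algebraMap F E)]
    have hsplit : (G.map (algebraMap F E)).Splits := IsAlgClosed.splits _
    have hnodup := nodup_roots (hsep.map (f := algebraMap F E))
    have h0 : G.map (algebraMap F E) ≠ 0 := (hG.map _).ne_zero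
    rw [hsplit.dvd_iff_roots_le_roots h0, Multiset.le_iff_subset hnodup]
    · intro γ hγ
      rw [mem_roots h0, IsRoot, eval_map_algebraMap] at hγ
      obtain ⟨a, ha, h⟩ := hsurj γ hγ
      rw [mem_roots (hPmon.map _).ne_zero, IsRoot, eval_map_algebraMap, map_prod]
      refine Finset.prod_eq_zero ha ?_
      rw [← h, minpoly.aeval]
    · exact (hPmon.map _).ne_zero
  · apply Finset.prod_dvd_of_coprime
    · intro a ha b hb hab
      rw [Function.onFun, (minpoly.irreducible (hint (g a))).coprime_iff_not_dvd]
      intro h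
      refine hab (hinj a ha b hb ?_)
      exact eq_of_monic_of_associated (minpoly.monic (hint _)) (minpoly.monic (hint _))
        ((minpoly.irreducible (hint (g a))).associated_of_dvd
          (minpoly.irreducible (hint (g b))) h)
    · intro a ha
      exact minpoly.dvd F _ (hroot a ha)

omit [Algebra.IsAlgebraic F E] [IsAlgClosed E] in
-- `f(X ^ n)` is coprime to each factor of its derivative: to `n` and `X` since `n ≠ 0` and `f(0) ≠
-- 0`, to `f'(X ^ n)` by separability of `f`.
lemma separable_comp_X_pow {f : F[X]} (hf : f.Separable) (h0 : f.coeff 0 ≠ 0) {n : ℕ}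
    (hn : (n : F) ≠ 0) : (f.comp (X ^ n)).Separable := by
  have hn0 : n ≠ 0 := by rintro rfl; simp at hn
  rw [Separable, derivative_comp, derivative_X_pow]
  have h1 : IsCoprime (f.comp (X ^ n)) (f.derivative.comp (X ^ n)) :=
    IsCoprime.map hf (compRingHom (X ^ n))
  have h2 : IsCoprime (f.comp (X ^ n)) X := by
    rw [isCoprime_comm, irreducible_X.coprime_iff_not_dvd, X_dvd_iff, coeff_zero_eq_eval_zero,
      eval_comp]
    simpa [hn0, coeff_zero_eq_eval_zero] using h0
  have h3 : IsCoprime (f.comp (X ^ n)) (C (n : F)) :=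
    ⟨0, C (n : F)⁻¹, by rw [zero_mul, zero_add, ← C_mul, inv_mul_cancel₀ hn, C_1]⟩
  exact (h3.mul_right h2.pow_right).mul_right h1

end Product

/-! ### Maximality of gcds, and orbits of a diagonal shift. -/

section Arithmetic

/-- As `p ∤ g`, the full `p`-part of `d` survives in `d / g`. -/
lemma prime_mul_dvd_of_dvd {p d g A : ℕ} (hp : p.Prime) (hg : g ∣ d) (hpg : ¬ p ∣ g)
    (hA : d ∣ A) (h : p * (d / g) ∣ A) : p * d ∣ A := by
  rcases Nat.eq_zero_or_pos d with rfl | hd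
  · simpa using hA
  obtain ⟨D, rfl⟩ := hg
  have hg0 : 0 < g := Nat.pos_of_mul_pos_right hd
  have hD0 : 0 < D := Nat.pos_of_mul_pos_left hd
  rw [Nat.mul_div_cancel_left _ hg0] at h
  obtain ⟨B, rfl⟩ := (dvd_mul_left D p).trans h
  rw [mul_comm p D, Nat.mul_dvd_mul_iff_left hD0] at h
  rw [mul_comm g D, Nat.mul_dvd_mul_iff_left hD0] at hA
  have := ((Nat.Prime.coprime_iff_not_dvd hp).2 hpg).mul_dvd_of_dvd_of_dvd h hA
  calc p * (g * D) = D * (p * g) := by ring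
    _ ∣ D * B := mul_dvd_mul_left D this

lemma not_prime_mul_gcd_dvd {p n A : ℕ} (hp : p.Prime) (hn : 0 < n)
    (h : p ∣ n / Nat.gcd n A) : ¬ p * Nat.gcd n A ∣ A := by
  intro hA
  have hg : 0 < Nat.gcd n A := Nat.gcd_pos_of_pos_left _ hn
  have h1 : p * Nat.gcd n A ∣ n := by
    calc p * Nat.gcd n A ∣ n / Nat.gcd n A * Nat.gcd n A := mul_dvd_mul_right h _
      _ = n := Nat.div_mul_cancel (Nat.gcd_dvd_left _ _)
  have h2 := Nat.le_of_dvd hg (Nat.dvd_gcd h1 hA)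
  have := hp.two_le
  nlinarith

/-- Every orbit of the shift by `(1, 1)` on `ℤ/t × ℤ/s` contains some `(m, 0)` with `m < gcd(t, s)`;
this is where the range of `m` comes from. -/
lemma exists_add_modEq {t s : ℕ} (ht : 0 < t) (l m₀ : ℕ) :
    ∃ m < Nat.gcd t s, ∃ u, u ≡ m₀ [MOD s] ∧ m + u ≡ l [MOD t] := by
  have hg : 0 < Nat.gcd t s := Nat.gcd_pos_of_pos_left _ ht
  obtain ⟨g', hg'⟩ : ∃ g', Nat.gcd t s = g' + 1 := ⟨Nat.gcd t s - 1, by omega⟩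
  obtain ⟨t', ht'⟩ : ∃ t', t = t' + 1 := ⟨t - 1, by omega⟩
  -- This is `l - m₀` modulo the gcd: `g'` stands for `-1` there, as `t'` does modulo `t`.
  set m := (l + m₀ * g') % Nat.gcd t s with hm
  have hmt : m + (l + t' * m) ≡ l [MOD t] := by
    have : m + (l + t' * m) = l + t * m := by rw [ht']; ring
    rw [this]
    simp [Nat.ModEq]
  have hm0 : m + m₀ ≡ l [MOD Nat.gcd t s] := by
    have h1 : m ≡ l + m₀ * g' [MOD Nat.gcd t s] := Nat.mod_modEq _ _
    refine (h1.add_right m₀).trans ?_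
    have : l + m₀ * g' + m₀ = l + Nat.gcd t s * m₀ := by rw [hg']; ring
    rw [this]
    simp [Nat.ModEq]
  have hcrt : m₀ ≡ l + t' * m [MOD Nat.gcd s t] := by
    rw [Nat.gcd_comm]
    exact (hm0.trans (hmt.of_dvd (Nat.gcd_dvd_left t s)).symm).add_left_cancel' m
  obtain ⟨u, hu1, hu2⟩ := Nat.chineseRemainder' hcrt
  exact ⟨m, Nat.mod_lt _ hg, u, hu1, (hu2.add_left m).trans hmt⟩

end Arithmetic

/-- A root of unity of order dividing `n₂` has a power which lies in the group of
`d₂`-th roots of unity, in a normalized way. -/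
lemma exists_pow_eq_pow_of_pow_eq_one {E : Type*} [Field E] {n₂ d₂ : ℕ} (hn₂ : 0 < n₂)
    (hd : d₂ ∣ n₂) (hp : ∀ p, p.Prime → p ∣ n₂ → p ∣ d₂) {ζ w : E}
    (hζ : IsPrimitiveRoot ζ d₂) (hw : w ^ n₂ = 1) :
    ∃ v ∈ (n₂ / d₂).divisors, ∃ i, Nat.gcd i v = 1 ∧ w ^ v = ζ ^ i := by
  have hd0 : 0 < d₂ := Nat.pos_of_dvd_of_pos hd hn₂
  have : NeZero d₂ := ⟨hd0.ne'⟩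
  set o := orderOf w with ho
  have hon : o ∣ n₂ := orderOf_dvd_of_pow_eq_one hw
  have ho0 : 0 < o := Nat.pos_of_dvd_of_pos hon hn₂
  have hg0 : 0 < Nat.gcd o d₂ := Nat.gcd_pos_of_pos_right _ hd0
  -- This exponent lowers the order of `w` to `gcd(o, d₂)`, and `d₂ * v = lcm(o, d₂)` divides `n₂`.
  set v := o / Nat.gcd o d₂ with hv
  have hv0 : 0 < v := Nat.div_pos (Nat.le_of_dvd ho0 (Nat.gcd_dvd_left _ _)) hg0
  have hvo : v ∣ o := Nat.div_dvd_of_dvd (Nat.gcd_dvd_left _ _)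
  have hord : orderOf (w ^ v) = Nat.gcd o d₂ := by
    rw [orderOf_pow_of_dvd hv0.ne' hvo, ← ho, hv,
      Nat.div_div_self (Nat.gcd_dvd_left _ _) ho0.ne']
  have hone : (w ^ v) ^ d₂ = 1 := by
    rw [← orderOf_dvd_iff_pow_eq_one, hord]; exact Nat.gcd_dvd_right _ _
  obtain ⟨i, -, hi⟩ := hζ.eq_pow_of_pow_eq_one hone
  refine ⟨v, ?_, i, ?_, hi.symm⟩
  · rw [Nat.mem_divisors]
    refine ⟨?_, (Nat.div_pos (Nat.le_of_dvd hn₂ hd) hd0).ne'⟩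
    rw [Nat.dvd_div_iff_mul_dvd hd]
    have : d₂ * v = Nat.lcm o d₂ := by
      rw [hv, Nat.lcm, ← Nat.mul_div_assoc _ (Nat.gcd_dvd_left _ _), mul_comm]
    rw [this]
    exact Nat.lcm_dvd hon hd
  · apply Nat.coprime_of_dvd
    -- Such a `p` would divide both `o / gcd(o, d₂)` and `d₂ / gcd(o, d₂)`, which are coprime.
    intro p hpp hpi hpv
    have hpd : p ∣ d₂ := hp p hpp (hpv.trans (hvo.trans hon))
    have hfin : IsOfFinOrder ζ := isOfFinOrder_iff_pow_eq_one.2 ⟨d₂, hd0, hζ.pow_eq_one⟩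
    rw [← hi, hfin.orderOf_pow, ← hζ.eq_orderOf] at hord
    have h1 : d₂ / Nat.gcd o d₂ = Nat.gcd d₂ i := by
      rw [← hord, Nat.div_div_self (Nat.gcd_dvd_left _ _) hd0.ne']
    have h2 : p ∣ d₂ / Nat.gcd o d₂ := h1 ▸ Nat.dvd_gcd hpd hpi
    have h3 := Nat.dvd_gcd hpv h2
    rw [Nat.coprime_div_gcd_div_gcd hg0] at h3
    exact hpp.one_lt.ne' (Nat.dvd_one.1 h3)

/-- The numerical data of the factorization of `f (X ^ (n₁ * n₂))`, where `f` is the minimal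
polynomial of `α`. -/
structure FactorData (F : Type*) {E : Type*} [Field F] [Field E] [Algebra F E]
    (k Q e n₁ n₂ s d₁ d₂ s₁ : ℕ) (t : ℕ → ℕ) (α ζ₁ ζ₂ β : E) : Prop where
  k_eq : k = (minpoly F α).natDegree
  Q_eq : Q = Nat.card F ^ k
  α_ne : α ≠ 0
  e_eq : e = orderOf α
  n₁_pos : 0 < n₁
  n₂_pos : 0 < n₂
  dvd_e : ∀ p, p.Prime → p ∣ n₁ → p ∣ e
  coprime_e : n₂.Coprime e
  s_pos : 0 < s
  dvd_s : ∀ p, p.Prime → p ∣ n₁ * n₂ → p ∣ Q ^ s - 1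
  four_dvd_s : 4 ∣ n₁ * n₂ → 4 ∣ Q ^ s - 1
  d₁_eq : d₁ = Nat.gcd n₁ ((Q ^ s - 1) / e)
  d₂_eq : d₂ = Nat.gcd n₂ (Q ^ s - 1)
  s₁_iff : ∀ u, e * d₁ ∣ Q ^ u - 1 ↔ s₁ ∣ u
  t_iff : ∀ i u, d₂ / Nat.gcd i d₂ ∣ Q ^ u - 1 ↔ t i ∣ u
  ζ₁_prim : IsPrimitiveRoot ζ₁ d₁
  ζ₂_prim : IsPrimitiveRoot ζ₂ d₂
  β_pow : β ^ d₁ = α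

/-! ### The binomials `X ^ T - x`, their roots, and the indexing of the factors. -/

namespace FactorData

set_option linter.unusedSectionVars false

variable {F E : Type*} [Field F] [Finite F] [Field E] [Algebra F E] [Algebra.IsAlgebraic F E]
  {k Q e n₁ n₂ s d₁ d₂ s₁ : ℕ} {t : ℕ → ℕ} {α ζ₁ ζ₂ β : E}

section

variable (D : FactorData F k Q e n₁ n₂ s d₁ d₂ s₁ t α ζ₁ ζ₂ β)
include D

lemma k_pos : 0 < k := D.k_eq ▸ natDegree_minpoly_pos α

lemma one_lt_Q : 1 < Q := D.Q_eq ▸ Nat.one_lt_pow D.k_pos.ne' Finite.one_lt_card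

lemma e_dvd_iff (u : ℕ) : e ∣ Nat.card F ^ u - 1 ↔ k ∣ u := by
  rw [D.e_eq, D.k_eq]; exact orderOf_dvd_card_pow_sub_one_iff D.α_ne u

lemma e_pos : 0 < e := D.e_eq ▸ orderOf_pos_of_ne_zero F D.α_ne

lemma e_dvd (u : ℕ) : e ∣ Q ^ u - 1 := by
  rw [D.Q_eq, ← pow_mul]; exact (D.e_dvd_iff _).2 (dvd_mul_right _ _)

lemma d₁_dvd : d₁ ∣ n₁ := D.d₁_eq ▸ Nat.gcd_dvd_left _ _

lemma d₂_dvd : d₂ ∣ n₂ := D.d₂_eq ▸ Nat.gcd_dvd_left _ _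

lemma d₁_pos : 0 < d₁ := Nat.pos_of_dvd_of_pos D.d₁_dvd D.n₁_pos

lemma d₂_pos : 0 < d₂ := Nat.pos_of_dvd_of_pos D.d₂_dvd D.n₂_pos

lemma e_mul_d₁_dvd : e * d₁ ∣ Q ^ s - 1 := by
  calc e * d₁ ∣ e * ((Q ^ s - 1) / e) :=
        mul_dvd_mul_left _ (D.d₁_eq ▸ Nat.gcd_dvd_right _ _)
    _ = Q ^ s - 1 := Nat.mul_div_cancel' (D.e_dvd s)

lemma d₂_dvd_pow : d₂ ∣ Q ^ s - 1 := D.d₂_eq ▸ Nat.gcd_dvd_right _ _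

lemma s₁_pos : 0 < s₁ :=
  Nat.pos_of_dvd_of_pos ((D.s₁_iff s).1 D.e_mul_d₁_dvd) D.s_pos

lemma t_dvd (i : ℕ) : t i ∣ s :=
  (D.t_iff i s).1 ((Nat.div_dvd_of_dvd (Nat.gcd_dvd_right _ _)).trans D.d₂_dvd_pow)

lemma t_pos (i : ℕ) : 0 < t i := Nat.pos_of_dvd_of_pos (D.t_dvd i) D.s_pos

lemma coprime_d₂_Q : d₂.Coprime Q := by
  apply Nat.coprime_of_dvd
  intro p hp h1 h2
  have h3 := h1.trans D.d₂_dvd_pow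
  have := (Nat.dvd_sub_iff_right (Nat.one_le_pow _ _ (by have := D.one_lt_Q; omega))
    (h2.trans (dvd_pow_self Q D.s_pos.ne'))).1 h3
  exact hp.one_lt.ne' (Nat.dvd_one.1 this)

lemma prime_dvd_d₂ {p : ℕ} (hp : p.Prime) (h : p ∣ n₂) : p ∣ d₂ := by
  rw [D.d₂_eq]; exact Nat.dvd_gcd h (D.dvd_s p hp (h.mul_left n₁))

lemma coprime_e_mul_d₁ {v : ℕ} (hv : v ∣ n₂) : v.Coprime (e * d₁) := by
  have h1 : v.Coprime e := D.coprime_e.coprime_dvd_left hv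
  refine h1.mul_right ?_
  apply Nat.coprime_of_dvd
  intro p hp hpv hpd
  have := Nat.dvd_gcd hpv (D.dvd_e p hp (hpd.trans D.d₁_dvd))
  rw [h1] at this
  exact hp.one_lt.ne' (Nat.dvd_one.1 this)

lemma orderOf_eq {b : E} (hb : b ^ d₁ = α) : orderOf b = e * d₁ := by
  rw [mul_comm]
  exact orderOf_eq_mul_of_pow D.d₁_pos (by rw [hb, D.e_eq])
    fun p hp h => D.dvd_e p hp (h.trans D.d₁_dvd)

lemma ne_zero {b : E} (hb : b ^ d₁ = α) : b ≠ 0 := by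
  rintro rfl
  rw [zero_pow D.d₁_pos.ne'] at hb
  exact D.α_ne hb.symm

lemma pow_Q_eq_iff {b : E} (hb : b ^ d₁ = α) (a c : ℕ) :
    b ^ Q ^ a = b ^ Q ^ c ↔ a ≡ c [MOD s₁] := by
  rw [D.Q_eq]
  refine pow_card_pow_eq_pow_card_pow_iff F k (fun u => ?_) a c
  rw [← D.Q_eq, pow_eq_self_iff_orderOf_dvd (D.ne_zero hb)
    (Nat.pow_pos (by have := D.one_lt_Q; omega)), D.orderOf_eq hb, D.s₁_iff]

lemma conj_pow (j : ℕ) : (ζ₁ ^ j * β) ^ d₁ = α := by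
  rw [mul_pow, ← pow_mul, mul_comm j, pow_mul, D.ζ₁_prim.pow_eq_one, one_pow, one_mul, D.β_pow]

lemma exists_conj_eq {b : E} (hb : b ^ d₁ = α) : ∃ j < d₁, b = ζ₁ ^ j * β := by
  have : NeZero d₁ := ⟨D.d₁_pos.ne'⟩
  have hβ := D.ne_zero D.β_pow
  have h1 : (b / β) ^ d₁ = 1 := by rw [div_pow, hb, D.β_pow, div_self D.α_ne]
  obtain ⟨j, hj, h⟩ := D.ζ₁_prim.eq_pow_of_pow_eq_one h1
  exact ⟨j, hj, by rw [h, div_mul_cancel₀ _ hβ]⟩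

/-- The relation is conjugacy of the `d₁`-th roots of `α` under the `Q`-power map; the bound `m <
s₁` costs nothing because these orbits have length `s₁`. -/
lemma expRel_iff (j j' : ℕ) :
    expRel Q s₁ ζ₁ β j j' ↔ ∃ m, ζ₁ ^ j' * β = (ζ₁ ^ j * β) ^ Q ^ m := by
  have hβ := D.ne_zero D.β_pow
  have key : ∀ m, ζ₁ ^ j' = ζ₁ ^ (j * Q ^ m) * β ^ (Q ^ m - 1) ↔
      ζ₁ ^ j' * β = (ζ₁ ^ j * β) ^ Q ^ m := by
    intro m
    have : β ^ Q ^ m = β ^ (Q ^ m - 1) * β := by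
      rw [← pow_succ, Nat.sub_add_cancel (Nat.one_le_pow _ _ (by have := D.one_lt_Q; omega))]
    rw [mul_pow, ← pow_mul, this, ← mul_assoc]
    exact ⟨fun h => by rw [h], fun h => mul_right_cancel₀ hβ h⟩
  constructor
  · rintro ⟨m, -, h⟩
    exact ⟨m, (key m).1 h⟩
  · rintro ⟨m, h⟩
    refine ⟨m % s₁, Nat.mod_lt _ D.s₁_pos, (key _).2 ?_⟩
    rw [h, D.pow_Q_eq_iff (D.conj_pow j)]
    exact (Nat.mod_modEq _ _).symm

lemma expRel_equivalence :
    Equivalence (fun j j' : Fin d₁ => expRel Q s₁ ζ₁ β j j') := by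
  constructor
  · intro j
    exact (D.expRel_iff _ _).2 ⟨0, by simp⟩
  · intro j j' h
    obtain ⟨m, hm⟩ := (D.expRel_iff _ _).1 h
    refine (D.expRel_iff _ _).2 ⟨m * (s₁ - 1), ?_⟩
    rw [hm, ← pow_mul, ← pow_add]
    have h0 := (D.pow_Q_eq_iff (D.conj_pow j) (m + m * (s₁ - 1)) 0).2 (by
      have : m + m * (s₁ - 1) = s₁ * m := by
        obtain ⟨s', hs'⟩ : ∃ s', s₁ = s' + 1 := ⟨s₁ - 1, by have := D.s₁_pos; omega⟩
        rw [hs', Nat.add_sub_cancel]; ring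
      rw [this]
      simp [Nat.ModEq])
    rw [h0]; simp
  · intro j j' j'' h h'
    obtain ⟨m, hm⟩ := (D.expRel_iff _ _).1 h
    obtain ⟨m', hm'⟩ := (D.expRel_iff _ _).1 h'
    exact (D.expRel_iff _ _).2 ⟨m + m', by rw [hm', hm, ← pow_mul, ← pow_add]⟩

lemma orderOf_ζ₂_pow (i m : ℕ) : orderOf (ζ₂ ^ (i * Q ^ m)) = d₂ / Nat.gcd i d₂ := by
  have hfin : IsOfFinOrder ζ₂ := isOfFinOrder_iff_pow_eq_one.2
    ⟨d₂, D.d₂_pos, D.ζ₂_prim.pow_eq_one⟩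
  rw [hfin.orderOf_pow, ← D.ζ₂_prim.eq_orderOf,
    (D.coprime_d₂_Q.pow_right m).symm.gcd_mul_right_cancel_right, Nat.gcd_comm]

lemma ζ₂_pow_eq_iff (a b : ℕ) : ζ₂ ^ a = ζ₂ ^ b ↔ a ≡ b [MOD d₂] := by
  have hfin : IsOfFinOrder ζ₂ := isOfFinOrder_iff_pow_eq_one.2
    ⟨d₂, D.d₂_pos, D.ζ₂_prim.pow_eq_one⟩
  rw [hfin.pow_eq_pow_iff_modEq, ← D.ζ₂_prim.eq_orderOf]

lemma ζ₂_pow_Q_eq_iff (i a c : ℕ) :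
    ζ₂ ^ (i * Q ^ a) = ζ₂ ^ (i * Q ^ c) ↔ a ≡ c [MOD t i] := by
  have hne : ζ₂ ^ i ≠ 0 := pow_ne_zero _ (D.ζ₂_prim.ne_zero D.d₂_pos.ne')
  have ho : orderOf (ζ₂ ^ i) = d₂ / Nat.gcd i d₂ := by simpa using D.orderOf_ζ₂_pow i 0
  rw [pow_mul, pow_mul, D.Q_eq]
  refine pow_card_pow_eq_pow_card_pow_iff F k (fun u => ?_) a c
  rw [← D.Q_eq, pow_eq_self_iff_orderOf_dvd hne
    (Nat.pow_pos (by have := D.one_lt_Q; omega)), ho, D.t_iff]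

lemma orderOf_binomial_const {r v : ℕ} (hr : r.Coprime (e * d₁)) (hv : v ∣ n₂) (i m : ℕ)
    {b : E} (hb : b ^ d₁ = α) :
    orderOf (ζ₂ ^ (i * Q ^ m) * b ^ (r * v)) = e * d₁ * (d₂ / Nat.gcd i d₂) := by
  have h1 : orderOf (b ^ (r * v)) = e * d₁ := by
    rw [← D.orderOf_eq hb]
    apply Nat.Coprime.orderOf_pow
    rw [D.orderOf_eq hb]
    exact (hr.mul_left (D.coprime_e_mul_d₁ hv)).symm
  rw [(Commute.all _ _).orderOf_mul_eq_mul_orderOf_of_coprime, D.orderOf_ζ₂_pow, h1, mul_comm]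
  rw [D.orderOf_ζ₂_pow, h1]
  exact D.coprime_e_mul_d₁ ((Nat.div_dvd_of_dvd (Nat.gcd_dvd_right _ _)).trans D.d₂_dvd)

lemma binomial_const_ne_zero {b : E} (hb : b ^ d₁ = α) (a c : ℕ) : ζ₂ ^ a * b ^ c ≠ 0 :=
  mul_ne_zero (pow_ne_zero _ (D.ζ₂_prim.ne_zero D.d₂_pos.ne')) (pow_ne_zero _ (D.ne_zero hb))

lemma coprime_e_mul_d₁_div (i : ℕ) : (e * d₁).Coprime (d₂ / Nat.gcd i d₂) :=
  (D.coprime_e_mul_d₁ ((Nat.div_dvd_of_dvd (Nat.gcd_dvd_right _ _)).trans D.d₂_dvd)).symm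

/-- The factor `e` forces `k ∣ u`; after that the coprime factors impose `s₁` and `t i` separately.
-/
lemma order_dvd_iff (i u : ℕ) : e * d₁ * (d₂ / Nat.gcd i d₂) ∣ Nat.card F ^ u - 1 ↔
    k * Nat.lcm (t i) s₁ ∣ u := by
  have hQ : ∀ u, e * d₁ * (d₂ / Nat.gcd i d₂) ∣ Q ^ u - 1 ↔ Nat.lcm (t i) s₁ ∣ u := by
    intro u
    rw [Nat.lcm_dvd_iff, ← D.s₁_iff, ← D.t_iff]
    exact ⟨fun h => ⟨(dvd_mul_left _ _).trans h, (dvd_mul_right _ _).trans h⟩,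
      fun h => (D.coprime_e_mul_d₁_div i).mul_dvd_of_dvd_of_dvd h.2 h.1⟩
  constructor
  · intro h
    obtain ⟨u, rfl⟩ := (D.e_dvd_iff u).1
      (((dvd_mul_right e d₁).trans (dvd_mul_right _ _)).trans h)
    rw [pow_mul, ← D.Q_eq, hQ] at h
    exact mul_dvd_mul_left k h
  · intro h
    obtain ⟨u, rfl⟩ := (dvd_mul_right k _).trans h
    rw [pow_mul, ← D.Q_eq, hQ]
    exact (Nat.mul_dvd_mul_iff_left D.k_pos).1 h

lemma natDegree_binomial_const {r v : ℕ} (hr : r.Coprime (e * d₁)) (hv : v ∣ n₂) (i m : ℕ)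
    {b : E} (hb : b ^ d₁ = α) :
    (minpoly F (ζ₂ ^ (i * Q ^ m) * b ^ (r * v))).natDegree = k * Nat.lcm (t i) s₁ := by
  have key : ∀ u, (minpoly F (ζ₂ ^ (i * Q ^ m) * b ^ (r * v))).natDegree ∣ u ↔
      k * Nat.lcm (t i) s₁ ∣ u := by
    intro u
    rw [← D.order_dvd_iff i u, ← D.orderOf_binomial_const hr hv i m hb,
      orderOf_dvd_card_pow_sub_one_iff (D.binomial_const_ne_zero hb _ _)]
  exact Nat.dvd_antisymm ((key _).2 dvd_rfl) ((key _).1 dvd_rfl)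

lemma exponent_pos {v : ℕ} (hv : v ∈ (n₂ / d₂).divisors) : 0 < n₁ / d₁ * v :=
  Nat.mul_pos (Nat.div_pos (Nat.le_of_dvd D.n₁_pos D.d₁_dvd) D.d₁_pos)
    (Nat.pos_of_mem_divisors hv)

lemma dvd_n₂ {v : ℕ} (hv : v ∈ (n₂ / d₂).divisors) : v ∣ n₂ :=
  (Nat.dvd_of_mem_divisors hv).trans (Nat.div_dvd_of_dvd D.d₂_dvd)

lemma prime_dvd_order {v i p : ℕ} (hv : v ∈ (n₂ / d₂).divisors) (hi : Nat.gcd i v = 1)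
    (hp : p.Prime) (hpT : p ∣ n₁ / d₁ * v) : p ∣ e * d₁ * (d₂ / Nat.gcd i d₂) := by
  rcases (hp.dvd_mul).1 hpT with h | h
  · exact ((D.dvd_e p hp (h.trans (Nat.div_dvd_of_dvd D.d₁_dvd))).mul_right _).mul_right _
  · have hpd := D.prime_dvd_d₂ hp (h.trans (D.dvd_n₂ hv))
    refine Dvd.dvd.mul_left ?_ _
    rw [← Nat.mul_div_cancel' (Nat.gcd_dvd_right i d₂)] at hpd
    refine ((hp.dvd_mul).1 hpd).resolve_left fun hpg => ?_
    have := Nat.dvd_gcd (hpg.trans (Nat.gcd_dvd_left _ _)) h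
    rw [hi] at this
    exact hp.one_lt.ne' (Nat.dvd_one.1 this)

/-- An extra factor `p` would enlarge `d₁` if `p ∣ n₁ / d₁`, or `d₂` if `p ∣ v`, contradicting that
they are gcds. -/
lemma not_prime_mul_order_dvd {v i p : ℕ} (hv : v ∈ (n₂ / d₂).divisors)
    (hi : Nat.gcd i v = 1) (hp : p.Prime) (hpT : p ∣ n₁ / d₁ * v) :
    ¬ p * (e * d₁ * (d₂ / Nat.gcd i d₂)) ∣ Q ^ s - 1 := by
  intro h
  rcases (hp.dvd_mul).1 hpT with h1 | h2
  · have h3 : p * d₁ ∣ (Q ^ s - 1) / e := by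
      rw [Nat.dvd_div_iff_mul_dvd (D.e_dvd s)]
      refine Dvd.dvd.trans ⟨d₂ / Nat.gcd i d₂, ?_⟩ h
      ring
    rw [D.d₁_eq] at h1 h3
    exact not_prime_mul_gcd_dvd hp D.n₁_pos h1 h3
  · have h3 : p * (d₂ / Nat.gcd i d₂) ∣ Q ^ s - 1 :=
      (mul_dvd_mul_left p (dvd_mul_left _ _)).trans h
    have hpg : ¬ p ∣ Nat.gcd i d₂ := fun hpg => by
      have := Nat.dvd_gcd (hpg.trans (Nat.gcd_dvd_left _ _)) h2
      rw [hi] at this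
      exact hp.one_lt.ne' (Nat.dvd_one.1 this)
    have h4 := prime_mul_dvd_of_dvd hp (Nat.gcd_dvd_right i d₂) hpg D.d₂_dvd_pow h3
    have h5 := h2.trans (Nat.dvd_of_mem_divisors hv)
    rw [D.d₂_eq] at h4 h5
    exact not_prime_mul_gcd_dvd hp D.n₂_pos h5 h4

lemma exponent_dvd {v : ℕ} (hv : v ∈ (n₂ / d₂).divisors) : n₁ / d₁ * v ∣ n₁ * n₂ :=
  mul_dvd_mul (Nat.div_dvd_of_dvd D.d₁_dvd) (D.dvd_n₂ hv)

lemma order_dvd_pow_sub_one (i : ℕ) : e * d₁ * (d₂ / Nat.gcd i d₂) ∣ Q ^ s - 1 :=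
  (D.coprime_e_mul_d₁_div i).mul_dvd_of_dvd_of_dvd D.e_mul_d₁_dvd
    ((Nat.div_dvd_of_dvd (Nat.gcd_dvd_right _ _)).trans D.d₂_dvd_pow)

/-- If the order `M` were twice an odd number, `4 ∣ Q ^ s - 1` would give `2 * M ∣ Q ^ s - 1`, which
maximality excludes. -/
lemma four_dvd_order {v i : ℕ} (hv : v ∈ (n₂ / d₂).divisors) (hi : Nat.gcd i v = 1)
    (h : 4 ∣ n₁ / d₁ * v) : 4 ∣ e * d₁ * (d₂ / Nat.gcd i d₂) := by
  have h2T : 2 ∣ n₁ / d₁ * v := (by norm_num : 2 ∣ 4).trans h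
  have h2 := D.prime_dvd_order hv hi Nat.prime_two h2T
  have h3 := D.not_prime_mul_order_dvd hv hi Nat.prime_two h2T
  have h4 := D.four_dvd_s (h.trans (D.exponent_dvd hv))
  have h5 := D.order_dvd_pow_sub_one i
  set M := e * d₁ * (d₂ / Nat.gcd i d₂)
  by_contra hM
  obtain ⟨m, hm⟩ := h2
  obtain ⟨A, hA⟩ := h5
  rw [hA] at h3 h4
  have hmo : ¬ 2 ∣ m := fun ⟨m', h'⟩ => hM ⟨m', by rw [hm, h']; ring⟩
  apply h3
  rw [mul_comm 2 M]
  refine mul_dvd_mul_left M ?_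
  have h6 : 2 ∣ m * A := by
    rw [hm, mul_assoc] at h4
    exact (Nat.mul_dvd_mul_iff_left two_pos).1 h4
  exact (Nat.prime_two.dvd_mul.1 h6).resolve_left hmo

/-- Irreducibility of the binomial over `F(x)`. The obstruction to `p * ord(x)` is known at level `k
* s` and descends because the degree of `x` divides `k * s`. -/
lemma root_facts {r v i m : ℕ} (hr : r.Coprime (e * d₁)) (hv : v ∈ (n₂ / d₂).divisors)
    (hi : Nat.gcd i v = 1) {b γ : E} (hb : b ^ d₁ = α)
    (hγ : γ ^ (n₁ / d₁ * v) = ζ₂ ^ (i * Q ^ m) * b ^ (r * v)) :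
    (minpoly F γ).natDegree = n₁ / d₁ * v * (k * Nat.lcm (t i) s₁) ∧
      orderOf γ = e * n₁ * v * (d₂ / Nat.gcd i d₂) := by
  have hT := D.exponent_pos hv
  have hx := D.binomial_const_ne_zero hb (i * Q ^ m) (r * v)
  have hγ0 : γ ≠ 0 := by
    rintro rfl
    rw [zero_pow hT.ne'] at hγ
    exact hx hγ.symm
  have hord := D.orderOf_binomial_const hr (D.dvd_n₂ hv) i m hb
  have hdeg := D.natDegree_binomial_const hr (D.dvd_n₂ hv) i m hb
  rw [← hγ] at hord hdeg
  have hcs : k * Nat.lcm (t i) s₁ ∣ k * s :=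
    mul_dvd_mul_left k (Nat.lcm_dvd (D.t_dvd i) ((D.s₁_iff s).1 D.e_mul_d₁_dvd))
  constructor
  · refine natDegree_minpoly_eq_mul hγ0 hT hord.symm hdeg.symm
      (fun p hp => D.prime_dvd_order hv hi hp) ?_ ?_
    · intro p hp hpT h
      apply D.not_prime_mul_order_dvd hv hi hp hpT
      rw [D.Q_eq, ← pow_mul]
      exact h.trans (Nat.pow_sub_one_dvd_pow_sub_one _ hcs)
    · by_cases h4 : 4 ∣ n₁ / d₁ * v
      · exact Or.inr ((D.four_dvd_order hv hi h4).trans ((D.order_dvd_iff i _).2 dvd_rfl))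
      · exact Or.inl h4
  · rw [orderOf_eq_mul_of_pow hT hord fun p hp => D.prime_dvd_order hv hi hp]
    calc n₁ / d₁ * v * (e * d₁ * (d₂ / Nat.gcd i d₂))
        = e * (d₁ * (n₁ / d₁)) * v * (d₂ / Nat.gcd i d₂) := by ring
      _ = _ := by rw [Nat.mul_div_cancel' D.d₁_dvd]

/-- Recovers `b` from `γ`: since `v ∣ n₂ / d₂`, also `d₂ ∣ n₂ / v`, which kills the power of `ζ₂`.
-/
lemma root_pow {r v i m : ℕ} (hr : ∀ b : E, b ^ d₁ = α → b ^ (r * n₂) = b)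
    (hv : v ∈ (n₂ / d₂).divisors) {b γ : E} (hb : b ^ d₁ = α)
    (hγ : γ ^ (n₁ / d₁ * v) = ζ₂ ^ (i * Q ^ m) * b ^ (r * v)) :
    γ ^ (n₁ / d₁ * n₂) = b := by
  have hvn := D.dvd_n₂ hv
  have hd : d₂ ∣ n₂ / v := by
    rw [Nat.dvd_div_iff_mul_dvd hvn, mul_comm, ← Nat.dvd_div_iff_mul_dvd D.d₂_dvd]
    exact Nat.dvd_of_mem_divisors hv
  obtain ⟨l, hl⟩ := hd
  have hn : n₂ = v * (n₂ / v) := (Nat.mul_div_cancel' hvn).symm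
  calc γ ^ (n₁ / d₁ * n₂) = (γ ^ (n₁ / d₁ * v)) ^ (n₂ / v) := by
        rw [← pow_mul, mul_assoc, ← hn]
    _ = (ζ₂ ^ d₂) ^ (l * (i * Q ^ m)) * b ^ (r * n₂) := by
        rw [hγ, mul_pow, ← pow_mul, ← pow_mul, ← pow_mul, mul_assoc r, ← hn, hl]
        congr 2; ring
    _ = b := by rw [D.ζ₂_prim.pow_eq_one, one_pow, one_mul, hr b hb]

lemma root_pow_n {b γ : E} (hb : b ^ d₁ = α) (hγ : γ ^ (n₁ / d₁ * n₂) = b) :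
    γ ^ (n₁ * n₂) = α := by
  rw [← hb, ← hγ, ← pow_mul]
  congr 1
  calc n₁ * n₂ = (n₁ / d₁ * d₁) * n₂ := by rw [Nat.div_mul_cancel D.d₁_dvd]
    _ = _ := by ring

/-- Coprimality of `i` and `v` makes `d₂ / gcd(i, d₂)` the gcd of the product with `d₂`, so the
order of a root determines `v`. -/
lemma unique_v {v v' i i' : ℕ}
    (hi : Nat.gcd i v = 1) (hi' : Nat.gcd i' v' = 1)
    (h : v * (d₂ / Nat.gcd i d₂) = v' * (d₂ / Nat.gcd i' d₂)) : v = v' := by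
  have key : ∀ v i, Nat.gcd i v = 1 →
      Nat.gcd (v * (d₂ / Nat.gcd i d₂)) d₂ = d₂ / Nat.gcd i d₂ := by
    intro v i hi
    have hco : v.Coprime (Nat.gcd i d₂) :=
      (Nat.Coprime.coprime_dvd_left (Nat.gcd_dvd_left i d₂) hi).symm
    calc Nat.gcd (v * (d₂ / Nat.gcd i d₂)) d₂
        = Nat.gcd (v * (d₂ / Nat.gcd i d₂)) (Nat.gcd i d₂ * (d₂ / Nat.gcd i d₂)) := by
          rw [Nat.mul_div_cancel' (Nat.gcd_dvd_right i d₂)]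
      _ = d₂ / Nat.gcd i d₂ := by rw [Nat.gcd_mul_right, hco, one_mul]
  have h1 : d₂ / Nat.gcd i d₂ = d₂ / Nat.gcd i' d₂ := by
    rw [← key v i hi, ← key v' i' hi', h]
  rw [h1] at h
  refine Nat.eq_of_mul_eq_mul_right ?_ h
  exact Nat.div_pos (Nat.le_of_dvd D.d₂_pos (Nat.gcd_dvd_right _ _))
    (Nat.gcd_pos_of_pos_right _ D.d₂_pos)

/-- The indices of a factor are determined by the factor. -/
lemma index_unique {r : ℕ} (hrc : r.Coprime (e * d₁))
    (hr : ∀ b : E, b ^ d₁ = α → b ^ (r * n₂) = b)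
    {J I : Finset ℕ} (hJ : IsRepSystem d₁ (expRel Q s₁ ζ₁ β) J) (hI : IsCycloRepSystem Q d₂ I)
    {j v i m j' v' i' m' : ℕ} (hj : j ∈ J) (hj' : j' ∈ J)
    (hv : v ∈ (n₂ / d₂).divisors) (hv' : v' ∈ (n₂ / d₂).divisors)
    (hiI : i ∈ I) (hiI' : i' ∈ I) (hi : Nat.gcd i v = 1) (hi' : Nat.gcd i' v' = 1)
    (hm : m < Nat.gcd (t i) s₁) (hm' : m' < Nat.gcd (t i') s₁) {γ γ' : E}
    (hγ : γ ^ (n₁ / d₁ * v) = ζ₂ ^ (i * Q ^ m) * (ζ₁ ^ j * β) ^ (r * v))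
    (hγ' : γ' ^ (n₁ / d₁ * v') = ζ₂ ^ (i' * Q ^ m') * (ζ₁ ^ j' * β) ^ (r * v'))
    (h : minpoly F γ = minpoly F γ') : j = j' ∧ v = v' ∧ i = i' ∧ m = m' := by
  have hb := D.conj_pow j
  have hb' := D.conj_pow j'
  have hord := (D.root_facts hrc hv hi hb hγ).2
  have hord' := (D.root_facts hrc hv' hi' hb' hγ').2
  rw [← polyOrder_minpoly (F := F), h, polyOrder_minpoly, hord'] at hord
  have hvv : v = v' := by
    refine D.unique_v hi hi' ?_
    refine Nat.eq_of_mul_eq_mul_left (Nat.mul_pos D.e_pos D.n₁_pos) ?_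
    rw [← mul_assoc, ← mul_assoc, hord]
  subst hvv
  obtain ⟨u, hu⟩ := (minpoly_eq_iff γ γ').1 h
  have hgb := D.root_pow hr hv hb hγ
  have hgb' := D.root_pow hr hv hb' hγ'
  -- Both roots have `n`-th power `α`, so the conjugation fixes `α` and is a power of the `Q`-power
  -- map.
  have hku : k ∣ u := by
    rw [D.k_eq, ← pow_card_pow_eq_self_iff]
    conv_rhs => rw [← D.root_pow_n hb hgb, hu]
    rw [pow_right_comm, D.root_pow_n hb' hgb']
  obtain ⟨u, rfl⟩ := hku
  rw [pow_mul, ← D.Q_eq] at hu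
  have hbb : ζ₁ ^ j * β = (ζ₁ ^ j' * β) ^ Q ^ u := by
    rw [← hgb, ← hgb', hu, pow_right_comm]
  have hjj : j = j' := by
    obtain ⟨j₀, -, huniq⟩ := hJ.2 j (hJ.1 j hj)
    rw [huniq j ⟨hj, (D.expRel_iff _ _).2 ⟨0, by simp⟩⟩,
      huniq j' ⟨hj', (D.expRel_iff _ _).2 ⟨u, hbb⟩⟩]
  subst hjj
  have hsu : u ≡ 0 [MOD s₁] := by
    rw [← D.pow_Q_eq_iff hb, ← hbb]; simp
  have hz : ζ₂ ^ (i * Q ^ m) = ζ₂ ^ (i' * Q ^ (m' + u)) := by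
    have h1 : γ ^ (n₁ / d₁ * v) = (γ' ^ (n₁ / d₁ * v)) ^ Q ^ u := by
      rw [hu, pow_right_comm]
    rw [hγ, hγ', mul_pow _ _ (Q ^ u), pow_right_comm (ζ₁ ^ j * β), ← hbb, ← pow_mul ζ₂,
      mul_assoc i', ← pow_add] at h1
    exact mul_right_cancel₀ (pow_ne_zero _ (D.ne_zero hb)) h1
  have hii : i = i' := by
    obtain ⟨i₀, -, huniq⟩ := hI (i * Q ^ m % d₂) (Nat.mod_lt _ D.d₂_pos)
    rw [huniq i ⟨hiI, m, rfl⟩, huniq i' ⟨hiI', m' + u, (D.ζ₂_pow_eq_iff _ _).1 hz⟩]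
  subst hii
  rw [D.ζ₂_pow_Q_eq_iff] at hz
  refine ⟨rfl, rfl, rfl, ?_⟩
  -- Modulo `gcd(t i, s₁)` the shift `u` vanishes, leaving `m ≡ m'`.
  have h1 := hz.of_dvd (Nat.gcd_dvd_left (t i) s₁)
  have h2 := (hsu.of_dvd (Nat.gcd_dvd_right (t i) s₁)).add_left m'
  exact (h1.trans h2).eq_of_lt_of_lt hm hm'

/-- Every root of `f (X ^ n)` is a conjugate of a root of one of the binomials. -/
lemma exists_index {r : ℕ} (hr : ∀ b : E, b ^ d₁ = α → b ^ (r * n₂) = b)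
    {J I : Finset ℕ} (hJ : IsRepSystem d₁ (expRel Q s₁ ζ₁ β) J) (hI : IsCycloRepSystem Q d₂ I)
    {γ : E} (hγ : γ ^ (n₁ * n₂) = α) :
    ∃ j ∈ J, ∃ v ∈ (n₂ / d₂).divisors, ∃ i ∈ I, Nat.gcd i v = 1 ∧
      ∃ m < Nat.gcd (t i) s₁, ∃ u, γ ^ (n₁ / d₁ * v) =
        (ζ₂ ^ (i * Q ^ m) * (ζ₁ ^ j * β) ^ (r * v)) ^ Q ^ u := by
  obtain ⟨y, hy⟩ : ∃ y, y = γ ^ (n₁ / d₁) := ⟨_, rfl⟩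
  obtain ⟨b, hby⟩ : ∃ b, b = y ^ n₂ := ⟨_, rfl⟩
  have hb : b ^ d₁ = α := by
    rw [hby, hy, ← hγ, ← pow_mul, ← pow_mul]
    congr 1
    calc n₁ / d₁ * (n₂ * d₁) = (n₁ / d₁ * d₁) * n₂ := by ring
      _ = _ := by rw [Nat.div_mul_cancel D.d₁_dvd]
  have hb0 := D.ne_zero hb
  obtain ⟨j', hj', hbj'⟩ := D.exists_conj_eq hb
  obtain ⟨j, ⟨hj, hrel⟩, -⟩ := hJ.2 j' hj'
  obtain ⟨m₀, hm₀⟩ := (D.expRel_iff _ _).1 hrel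
  -- `b ^ r` is an `n₂`-th root of `b`, as is `y`.
  have hw : (y / b ^ r) ^ n₂ = 1 := by
    rw [div_pow, ← hby, ← pow_mul, hr b hb, div_self hb0]
  obtain ⟨v, hv, i', hi', hwv⟩ := exists_pow_eq_pow_of_pow_eq_one D.n₂_pos D.d₂_dvd
    (fun p hp h => D.prime_dvd_d₂ hp h) D.ζ₂_prim hw
  obtain ⟨i, ⟨hi, l, hl⟩, -⟩ := hI (i' % d₂) (Nat.mod_lt _ D.d₂_pos)
  have hz : ζ₂ ^ i' = ζ₂ ^ (i * Q ^ l) := (D.ζ₂_pow_eq_iff _ _).2 hl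
  -- Primes of `v` divide `d₂`, so coprimality to `v` passes between members of a cyclotomic coset.
  have hiv : Nat.gcd i v = 1 := by
    apply Nat.coprime_of_dvd
    intro p hp hpi hpv
    have hpd := D.prime_dvd_d₂ hp (hpv.trans (D.dvd_n₂ hv))
    have hpi' : p ∣ i' := ((show i' ≡ i * Q ^ l [MOD d₂] from hl).dvd_iff hpd).2
      (hpi.mul_right _)
    have := Nat.dvd_gcd hpi' hpv
    rw [hi'] at this
    exact hp.one_lt.ne' (Nat.dvd_one.1 this)
  obtain ⟨m, hm, u, hu₁, hu₂⟩ := exists_add_modEq (s := s₁) (D.t_pos i) l m₀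
  refine ⟨j, hj, v, hv, i, hi, hiv, m, hm, u, ?_⟩
  have h1 : γ ^ (n₁ / d₁ * v) = ζ₂ ^ i' * b ^ (r * v) := by
    rw [pow_mul, ← hy, ← hwv, div_pow, ← pow_mul,
      div_mul_cancel₀ _ (pow_ne_zero _ hb0)]
  rw [h1, hz, mul_pow _ _ (Q ^ u), ← pow_mul ζ₂, mul_assoc i, ← pow_add, (D.ζ₂_pow_Q_eq_iff i _ _).2 hu₂,
    pow_right_comm, (D.pow_Q_eq_iff (D.conj_pow j) _ _).2 hu₁, ← hm₀, ← hbj']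

end

end FactorData

lemma card_cast_ne_zero_of_coprime {F : Type*} [Field F] [Finite F] {n : ℕ}
    (h : n.Coprime (Nat.card F)) : (n : F) ≠ 0 := by
  cases nonempty_fintype F
  intro h0
  obtain ⟨a, b, hab⟩ := Nat.isCoprime_iff_coprime.2 h
  have := congrArg (Int.cast : ℤ → F) hab
  push_cast at this
  rw [h0, Nat.card_eq_fintype_card, FiniteField.cast_card_eq_zero] at this
  simp at this

namespace FactorData

variable {F E : Type*} [Field F] [Finite F] [Field E] [Algebra F E] [Algebra.IsAlgebraic F E]
  {k Q e n₁ n₂ s d₁ d₂ s₁ : ℕ} {t : ℕ → ℕ} {α ζ₁ ζ₂ β : E}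

/-- The factorization of `f (X ^ n)` into minimal polynomials of roots of binomials. -/
lemma comp_X_pow_eq_prod [IsAlgClosed E]
    (D : FactorData F k Q e n₁ n₂ s d₁ d₂ s₁ t α ζ₁ ζ₂ β) (hn : ((n₁ * n₂ : ℕ) : F) ≠ 0)
    {r : ℕ} (hrc : r.Coprime (e * d₁)) (hr : ∀ b : E, b ^ d₁ = α → b ^ (r * n₂) = b)
    {J I : Finset ℕ} (hJ : IsRepSystem d₁ (expRel Q s₁ ζ₁ β) J) (hI : IsCycloRepSystem Q d₂ I)
    {g : ℕ → ℕ → ℕ → ℕ → E}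
    (hg : ∀ j, ∀ v ∈ (n₂ / d₂).divisors, ∀ i m,
      g j v i m ^ (n₁ / d₁ * v) = ζ₂ ^ (i * Q ^ m) * (ζ₁ ^ j * β) ^ (r * v)) :
    (minpoly F α).comp (X ^ (n₁ * n₂)) =
      ∏ j ∈ J, ∏ v ∈ (n₂ / d₂).divisors, ∏ i ∈ I with Nat.gcd i v = 1,
        ∏ m ∈ Finset.range (Nat.gcd (t i) s₁), minpoly F (g j v i m) := by
  have hint : IsIntegral F α := Algebra.IsIntegral.isIntegral α
  have hn0 : n₁ * n₂ ≠ 0 := (Nat.mul_pos D.n₁_pos D.n₂_pos).ne'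
  have h0 : (minpoly F α).coeff 0 ≠ 0 := minpoly.coeff_zero_ne_zero hint D.α_ne
  have hmon : ((minpoly F α).comp (X ^ (n₁ * n₂))).Monic :=
    (minpoly.monic hint).comp (monic_X_pow _) (by rw [natDegree_X_pow]; exact hn0)
  have hsep := separable_comp_X_pow (PerfectField.separable_of_irreducible
    (minpoly.irreducible hint)) h0 hn
  have hae : ∀ γ : E, aeval γ ((minpoly F α).comp (X ^ (n₁ * n₂))) =
      aeval (γ ^ (n₁ * n₂)) (minpoly F α) := fun γ => by simp [aeval_comp]
  have key := eq_prod_minpoly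
    (s := J.sigma fun _ => (n₂ / d₂).divisors.sigma fun v =>
      (I.filter fun i => Nat.gcd i v = 1).sigma fun i => Finset.range (Nat.gcd (t i) s₁))
    (g := fun a : (Σ _ : ℕ, Σ _ : ℕ, Σ _ : ℕ, ℕ) => g a.1 a.2.1 a.2.2.1 a.2.2.2) hmon hsep
    ?_ ?_ ?_
  · rw [key]
    simp only [Finset.prod_sigma]
  · rintro ⟨j, v, i, m⟩ ha
    simp only [Finset.mem_sigma, Finset.mem_filter, Finset.mem_range] at ha
    obtain ⟨-, hv, -, -⟩ := ha
    rw [hae, D.root_pow_n (D.conj_pow j) (D.root_pow hr hv (D.conj_pow j) (hg j v hv i m)),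
      minpoly.aeval]
  · rintro ⟨j, v, i, m⟩ ha ⟨j', v', i', m'⟩ ha' h
    simp only [Finset.mem_sigma, Finset.mem_filter, Finset.mem_range] at ha ha'
    obtain ⟨hj, hv, ⟨hi, hiv⟩, hm⟩ := ha
    obtain ⟨hj', hv', ⟨hi', hiv'⟩, hm'⟩ := ha'
    obtain ⟨rfl, rfl, rfl, rfl⟩ := D.index_unique hrc hr hJ hI hj hj' hv hv' hi hi' hiv hiv' hm hm'
      (hg j v hv i m) (hg j' v' hv' i' m') h
    rfl
  · intro γ hγ
    rw [hae] at hγ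
    have h1 : minpoly F (γ ^ (n₁ * n₂)) = minpoly F α :=
      (minpoly.eq_of_irreducible_of_monic (minpoly.irreducible hint) hγ (minpoly.monic hint)).symm
    -- Only `γ ^ n` conjugate to `α` is known; replacing `γ` by a conjugate makes the power equal to
    -- `α`.
    obtain ⟨u, hu⟩ := (minpoly_eq_iff _ _).1 h1.symm
    rw [pow_right_comm] at hu
    obtain ⟨j, hj, v, hv, i, hi, hiv, m, hm, w, hw⟩ := D.exists_index hr hJ hI hu.symm
    refine ⟨⟨j, v, i, m⟩, ?_, ?_⟩
    · simp only [Finset.mem_sigma, Finset.mem_filter, Finset.mem_range]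
      exact ⟨hj, hv, ⟨hi, hiv⟩, hm⟩
    · have hb := D.conj_pow j
      have hgx := hg j v hv i m
      rw [← hgx, D.Q_eq, ← pow_mul (Nat.card F)] at hw
      rw [← minpoly_pow_card_pow γ u]
      refine minpoly_eq_of_pow_eq (D.exponent_pos hv) ?_ (D.root_facts hrc hv hiv hb hgx).1 hw
      rw [hgx, D.natDegree_binomial_const hrc (D.dvd_n₂ hv) i m hb]

end FactorData

end PowerComp

/-! ### Assembly of the theorem. -/

open Polynomial in
theorem theorem27 {F E : Type*} [Field F] [Finite F] [Field E] [Algebra F E]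
    [IsAlgClosure F E]
    (q : ℕ) (hq : q = Nat.card F)
    (f : F[X]) (hf_monic : f.Monic) (hf_irr : Irreducible f) (hf_X : f ≠ X)
    (k : ℕ) (hk : k = f.natDegree)
    (α : E) (hα : aeval α f = 0)
    (n n₁ n₂ : ℕ) (hn : 0 < n) (hnq : Nat.Coprime n q) (hn12 : n = n₁ * n₂)
    (hn₁ : UniqueFactorizationMonoid.radical n₁ ∣ orderOf α)
    (hn₂ : Nat.Coprime n₂ (orderOf α))
    (s : ℕ) (hs : s = PowerComp.extDeg (q ^ k) n)
    (d₁ : ℕ) (hd₁ : d₁ = PowerComp.dOne (q ^ k) (orderOf α) n₁ s)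
    (d₂ : ℕ) (hd₂ : d₂ = PowerComp.dTwo (q ^ k) n₂ s)
    (s₁ : ℕ) (hs₁ : s₁ = PowerComp.sOne (q ^ k) (orderOf α) n₁ s)
    (t : ℕ → ℕ) (ht : ∀ i, t i = PowerComp.tNum (q ^ k) n₂ s i)
    (c : ℕ → ℕ) (hc : ∀ i, c i = PowerComp.cNum (q ^ k) (orderOf α) n₁ n₂ s i)
    (ζ₁ ζ₂ : E) (hζ₁ : IsPrimitiveRoot ζ₁ d₁) (hζ₂ : IsPrimitiveRoot ζ₂ d₂) :
    -- `β` exists in the subfield with `q ^ (k * s)` elements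
    (∃ β : E, β ^ q ^ (k * s) = β ∧ β ^ d₁ = α) ∧
    -- an exponent `r` exists
    (∃ r : ℕ, 0 < r ∧
      ((f = X - 1 ∧ r = 1) ∨ (f ≠ X - 1 ∧ r * n₂ ≡ 1 [MOD orderOf α * d₁]))) ∧
    -- the factorization, for every choice of `β`, `r` and the representatives
    ∀ β : E, β ^ q ^ (k * s) = β → β ^ d₁ = α →
      Equivalence (fun j j' : Fin d₁ => PowerComp.expRel (q ^ k) s₁ ζ₁ β j j') ∧
      ∀ r : ℕ, 0 < r →
        ((f = X - 1 ∧ r = 1) ∨ (f ≠ X - 1 ∧ r * n₂ ≡ 1 [MOD orderOf α * d₁])) →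
      ∀ J : Finset ℕ, PowerComp.IsRepSystem d₁ (PowerComp.expRel (q ^ k) s₁ ζ₁ β) J →
      ∀ I : Finset ℕ, PowerComp.IsCycloRepSystem (q ^ k) d₂ I →
      ∃ S : ℕ → ℕ → ℕ → ℕ → F[X],
        f.comp (X ^ n) =
          ∏ j ∈ J, ∏ v ∈ (n₂ / d₂).divisors, ∏ i ∈ I with Nat.gcd i v = 1,
            ∏ m ∈ Finset.range (Nat.gcd (t i) s₁), S j v i m ∧
        ∀ j ∈ J, ∀ v ∈ (n₂ / d₂).divisors, ∀ i ∈ I, Nat.gcd i v = 1 →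
          ∀ m < Nat.gcd (t i) s₁,
            (S j v i m).map (algebraMap F E) =
              PowerComp.explicitPoly q (n₁ / d₁ * v) (k * c i)
                (ζ₂ ^ (i * (q ^ k) ^ m) * (ζ₁ ^ j * β) ^ (r * v)) ∧
            (S j v i m).Monic ∧
            Irreducible (S j v i m) ∧
            (S j v i m).natDegree = k * (n₁ / d₁) * v * c i ∧
            PowerComp.polyOrder (S j v i m) =
              orderOf α * n₁ * v * (d₂ / Nat.gcd i d₂) ∧
            -- `S j v i m` is the `q`-spin of a binomial
            PowerComp.coeffDeg F (X ^ (n₁ / d₁ * v) -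
              C (ζ₂ ^ (i * (q ^ k) ^ m) * (ζ₁ ^ j * β) ^ (r * v))) = k * c i ∧
            (S j v i m).map (algebraMap F E) =
              PowerComp.spin F (X ^ (n₁ / d₁ * v) -
                C (ζ₂ ^ (i * (q ^ k) ^ m) * (ζ₁ ^ j * β) ^ (r * v))) := by
  classical
  subst hq hd₁ hd₂ hs₁
  have : IsAlgClosed E := IsAlgClosure.isAlgClosed F
  have : Algebra.IsAlgebraic F E := IsAlgClosure.isAlgebraic
  obtain rfl : f = minpoly F α := minpoly.eq_of_irreducible_of_monic hf_irr hα hf_monic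
  have hα0 : α ≠ 0 := by
    rintro rfl
    exact hf_X (minpoly.zero F E)
  have hn₁0 : 0 < n₁ := Nat.pos_of_mul_pos_right (hn12 ▸ hn)
  have hn₂0 : 0 < n₂ := Nat.pos_of_mul_pos_left (hn12 ▸ hn)
  have hk0 : 0 < k := hk ▸ PowerComp.natDegree_minpoly_pos α
  have hQ : 1 < Nat.card F ^ k := Nat.one_lt_pow hk0.ne' Finite.one_lt_card
  have hprime : ∀ p, p.Prime → p ∣ n₁ → p ∣ orderOf α := fun p hp h =>
    ((UniqueFactorizationMonoid.dvd_radical_iff_of_irreducible hp hn₁0.ne').2 h).trans hn₁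
  have he : orderOf α ∣ Nat.card F ^ k - 1 :=
    (PowerComp.orderOf_dvd_card_pow_sub_one_iff hα0 k).2 (hk ▸ dvd_rfl)
  obtain ⟨hs0, hps, h4s⟩ := PowerComp.extDeg_facts hQ hn (hnq.pow_right k)
  rw [← hs, hn12] at hps h4s
  rw [← hs] at hs0
  have hdata : ∀ β : E, β ^ PowerComp.dOne (Nat.card F ^ k) (orderOf α) n₁ s = α →
      PowerComp.FactorData F k (Nat.card F ^ k) (orderOf α) n₁ n₂ s
        (PowerComp.dOne (Nat.card F ^ k) (orderOf α) n₁ s)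
        (PowerComp.dTwo (Nat.card F ^ k) n₂ s)
        (PowerComp.sOne (Nat.card F ^ k) (orderOf α) n₁ s) t α ζ₁ ζ₂ β := fun β hβ =>
    { k_eq := hk
      Q_eq := rfl
      α_ne := hα0
      e_eq := rfl
      n₁_pos := hn₁0
      n₂_pos := hn₂0
      dvd_e := hprime
      coprime_e := hn₂
      s_pos := hs0
      dvd_s := hps
      four_dvd_s := h4s
      d₁_eq := rfl
      d₂_eq := rfl
      s₁_iff := fun u => PowerComp.mul_dOne_dvd_iff hQ he hprime
      t_iff := fun i u => by rw [ht]; exact PowerComp.dvd_tNum_iff (by omega) hn₂0 u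
      ζ₁_prim := hζ₁
      ζ₂_prim := hζ₂
      β_pow := hβ }
  have hd₁0 : 0 < PowerComp.dOne (Nat.card F ^ k) (orderOf α) n₁ s :=
    Nat.gcd_pos_of_pos_left _ hn₁0
  obtain ⟨β₀, hβ₀⟩ := IsAlgClosed.exists_pow_nat_eq α hd₁0
  have D₀ := hdata β₀ hβ₀
  refine ⟨⟨β₀, ?_, hβ₀⟩, ?_, fun β _ hβ => ?_⟩
  · rw [pow_mul, PowerComp.pow_eq_self_iff_orderOf_dvd (D₀.ne_zero hβ₀)
      (Nat.pow_pos (by omega)), D₀.orderOf_eq hβ₀]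
    exact D₀.e_mul_d₁_dvd
  · by_cases hf1 : minpoly F α = X - 1
    · exact ⟨1, one_pos, Or.inl ⟨hf1, rfl⟩⟩
    · obtain ⟨r, -, hr⟩ := Nat.exists_mul_mod_eq_of_coprime 1 (D₀.coprime_e_mul_d₁ dvd_rfl)
        (Nat.mul_pos D₀.e_pos hd₁0).ne'
      -- Adding the modulus guarantees positivity.
      refine ⟨r + orderOf α * PowerComp.dOne (Nat.card F ^ k) (orderOf α) n₁ s,
        Nat.add_pos_right _ (Nat.mul_pos D₀.e_pos hd₁0), Or.inr ⟨hf1, ?_⟩⟩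
      rw [mul_comm] at hr
      unfold Nat.ModEq
      rw [← hr, add_mul]
      simp
  have D := hdata β hβ
  refine ⟨D.expRel_equivalence, fun r _ hr J hJ I hI => ?_⟩
  have hmod : r * n₂ ≡ 1
      [MOD orderOf α * PowerComp.dOne (Nat.card F ^ k) (orderOf α) n₁ s] := by
    -- For `f = X - 1` one has `α = 1`, hence `n₁ = 1` and modulus 1, so the congruence holds there
    -- too.
    rcases hr with ⟨hf1, -⟩ | ⟨-, hr⟩
    · have hα1 : α = 1 := by
        rw [hf1] at hα
        simpa [sub_eq_zero] using hα
      have hn₁1 : n₁ = 1 := by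
        by_contra hne
        obtain ⟨p, hp, hpn⟩ := Nat.exists_prime_and_dvd hne
        have := hprime p hp hpn
        rw [hα1, orderOf_one] at this
        exact hp.one_lt.ne' (Nat.dvd_one.1 this)
      have hone : orderOf α * PowerComp.dOne (Nat.card F ^ k) (orderOf α) n₁ s = 1 := by
        rw [hα1, orderOf_one, hn₁1, PowerComp.dOne, Nat.gcd_one_left]
      rw [hone]
      exact Nat.modEq_one
    · exact hr
  have hrc : r.Coprime (orderOf α * PowerComp.dOne (Nat.card F ^ k) (orderOf α) n₁ s) :=
    Nat.Coprime.coprime_mul_right (k := n₂) (hmod.gcd_eq.trans (Nat.gcd_one_left _))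
  have hrb : ∀ b : E, b ^ PowerComp.dOne (Nat.card F ^ k) (orderOf α) n₁ s = α →
      b ^ (r * n₂) = b := by
    intro b hb
    conv_rhs => rw [← pow_one b]
    rw [(orderOf_pos_iff.1 (PowerComp.orderOf_pos_of_ne_zero F
      (D.ne_zero hb))).pow_eq_pow_iff_modEq, D.orderOf_eq hb]
    exact hmod
  have hroot : ∀ j v i m, ∃ γ : E, v ∈ (n₂ / PowerComp.dTwo (Nat.card F ^ k) n₂ s).divisors →
      γ ^ (n₁ / PowerComp.dOne (Nat.card F ^ k) (orderOf α) n₁ s * v) =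
        ζ₂ ^ (i * (Nat.card F ^ k) ^ m) * (ζ₁ ^ j * β) ^ (r * v) := by
    intro j v i m
    by_cases hv : v ∈ (n₂ / PowerComp.dTwo (Nat.card F ^ k) n₂ s).divisors
    · obtain ⟨γ, hγ⟩ := IsAlgClosed.exists_pow_nat_eq
        (ζ₂ ^ (i * (Nat.card F ^ k) ^ m) * (ζ₁ ^ j * β) ^ (r * v)) (D.exponent_pos hv)
      exact ⟨γ, fun _ => hγ⟩
    · exact ⟨0, fun h => absurd h hv⟩
  choose g hg using hroot
  refine ⟨fun j v i m => minpoly F (g j v i m), ?_, ?_⟩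
  · rw [hn12]
    exact D.comp_X_pow_eq_prod (PowerComp.card_cast_ne_zero_of_coprime (hn12 ▸ hnq)) hrc hrb hJ hI
      fun j v hv i m => hg j v i m hv
  · intro j _ v hv i _ hiv m _
    have hb := D.conj_pow j
    have hx := hg j v i m hv
    have hT := D.exponent_pos hv
    have hint : IsIntegral F (g j v i m) := Algebra.IsIntegral.isIntegral _
    have hc' : k * c i = k * Nat.lcm (t i) (PowerComp.sOne (Nat.card F ^ k) (orderOf α) n₁ s) := by
      rw [hc, ht, PowerComp.cNum]
    have hdegx := D.natDegree_binomial_const hrc (D.dvd_n₂ hv) i m hb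
    obtain ⟨hdeg, hord⟩ := D.root_facts hrc hv hiv hb hx
    rw [← hc'] at hdegx hdeg
    have hmap := PowerComp.map_minpoly_eq_prod_binomial hT (by rw [hx, hdegx]) hdeg
    rw [hx] at hmap
    refine ⟨?_, minpoly.monic hint, minpoly.irreducible hint, ?_, ?_, ?_, ?_⟩
    · rw [hmap, PowerComp.prod_binomial_eq_explicitPoly]
    · rw [hdeg]; ring
    · rw [PowerComp.polyOrder_minpoly, hord]
    · rw [PowerComp.coeffDeg_binomial hT, hdegx]
    · rw [hmap, PowerComp.spin_binomial hT, hdegx]
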